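/- **Setting.** Let $\Theta\subset\ell^2(\mathbb N)$ be a parameter set containing $\mathbb R^p$ (vectors padded with zeros), and let $(p_\theta)_{\theta\in\Theta}$ be probability densities with respect to a measure $\nu$ on a measurable space $\mathcal Z$; let $P_\theta$ be the law with density $p_\theta$, and $\ell(\theta,z)=\log p_\theta(z)$. For a fixed $\theta_0\in\Theta$ let $Z_1,\dots,Z_n$ be independent with law $P_{\theta_0}$, with joint law $\mathbb P^n_{\theta_0}$ and expectation $\mathbb E_{\theta_0}$, and let $\ell_n(\theta)=\sum_{i=1}^n\ell(\theta,Z_i)$. Norms of vectors are Euclidean, $\|\cdot\|_{\mathrm{op}}$ is the spectral norm, $\lambda_{\min}$ the smallest eigenvalue, and on a closed ball $\mathcal B$ derivatives are taken within $\mathcal B$ (so that at boundary points they are the continuous extensions from the interior). **Theorem.** Let $\kappa_1,\kappa_2,\kappa_3,\kappa_4\ge0$, $C>0$ and $C_1\ge C_2>0$. There are constants $c_{\max}\ge c_{\min}>0$, depending only on these numbers, and for every sequence $0<\delta_n\to0$ there is a constant $C'>0$, depending only on these numbers and on $(\delta_n)_{n\ge 1}$, such that the following holds for all $n,p\ge1$,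 all models as above, all $\theta_0\in\Theta$, $\theta_{*,p}\in\mathbb R^p$ and $0<\eta\le1$. Put $\mathcal B=\{\theta\in\mathbb R^p:\|\theta-\theta_{*,p}\|\le\eta\}$ and suppose that $\mathbb P^n_{\theta_0}$-almost surely $\ell_n$ is finite on $\mathcal B$ and $\ell_n\in C^2(\mathcal B)$. Suppose further that for all $v\in\mathbb R^p$ with $\|v\|\le1$ and all $i=1,\dots,n$: 1. (growth conditions) $p\le Cn\delta_n^2$ and $C\max(\delta_np^{\kappa_2},\,\eta\delta_np^{\kappa_4},\,\delta_n^2p^{\kappa_4})\log n\le p^{-\kappa_3}$; 2. (local mean boundedness) $|\mathbb E_{\theta_0}v^\top\nabla\ell(\theta_{*,p},Z_i)|\le C_1\delta_np^{\kappa_1}$, and for all integers $q\ge2$ $$\mathbb E_{\theta_0}|v^\top\nabla\ell(\theta_{*,p},Z_i)|^q\le\tfrac{q!}2C_1^q\,p^{2\kappa_1+(q-2)\kappa_2},$$ $$\sup_{\theta\in\mathcal B}\mathbb E_{\theta_0}|v^\top\nabla^2\ell(\theta,Z_i)v|^q\le\tfrac{q!}2C_1^q\,p^{2\kappa_2+(q-2)\kappa_4},$$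 $$\mathbb E_{\theta_0}|v^\top(\nabla^2\ell(\theta,Z_i)-\nabla^2\ell(\theta',Z_i))v|^q\le\tfrac{q!}2\big(C_1p^{\kappa_4}\|\theta-\theta'\|\big)^q\quad\text{for all }\theta,\theta'\in\mathcal B;$$ 3. (local mean curvature) $\inf_{\theta\in\mathcal B}\lambda_{\min}\big(\mathbb E_{\theta_0}[-\nabla^2\ell(\theta,Z_i)]\big)\ge C_2p^{-\kappa_3}$. Then there is an event $\mathcal E$ with $\mathbb P^n_{\theta_0}(\mathcal E)\ge1-C'e^{-Cn\delta_n^2}$ on which $$\|\nabla\ell_n(\theta_{*,p})\|\le c_{\max}n\delta_np^{\kappa_1},\qquad \sup_{\theta\in\mathcal B}\|\nabla^2\ell_n(\theta)\|_{\mathrm{op}}\le c_{\max}np^{\kappa_2},\qquad \inf_{\theta\in\mathcal B}\lambda_{\min}\big(-\nabla^2\ell_n(\theta)\big)\ge c_{\min}np^{-\kappa_3}.$$ -/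

import Mathlib

open MeasureTheory

noncomputable section

/-- The sequence space `ℓ²(ℕ)`. -/
abbrev EllTwo : Type := lp (fun _ : ℕ => ℝ) 2

/-- The inclusion of `ℝ^p` into `ℓ²(ℕ)` that pads a vector with zeros. -/
def embedRp (p : ℕ) (x : EuclideanSpace ℝ (Fin p)) : EllTwo :=
  ∑ i : Fin p, lp.single 2 (i : ℕ) (x i)

theorem embedRp_apply (p : ℕ) (x : EuclideanSpace ℝ (Fin p)) (k : ℕ) :
    (embedRp p x : ℕ → ℝ) k = if h : k < p then x ⟨k, h⟩ else 0 := by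
  unfold embedRp
  rw [lp.coeFn_sum, Finset.sum_apply]
  simp only [lp.single_apply]
  split_ifs with h
  · rw [Finset.sum_eq_single ⟨k, h⟩]
    · simp
    · intro b _ hb
      have : k ≠ (b : ℕ) := fun e => hb (Fin.ext e.symm)
      simp [this]
    · simp
  · refine Finset.sum_eq_zero fun b _ => ?_
    have : k ≠ (b : ℕ) := fun e => h (e ▸ b.isLt)
    simp [this]

/-- A dominated statistical model on the sample space `𝒵`: a parameter set `Θ ⊆ ℓ²(ℕ)`, a
dominating measure `ν`, and for every `θ ∈ Θ` a probability density `p_θ` with respect to `ν`. -/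
structure DominatedModel (𝒵 : Type*) [MeasurableSpace 𝒵] where
  Θ : Set EllTwo
  ν : Measure 𝒵
  pdf : EllTwo → 𝒵 → ℝ
  pdf_measurable : ∀ θ ∈ Θ, Measurable (pdf θ)
  pdf_nonneg : ∀ θ ∈ Θ, ∀ z, 0 ≤ pdf θ z
  lintegral_pdf : ∀ θ ∈ Θ, ∫⁻ z, ENNReal.ofReal (pdf θ z) ∂ν = 1

namespace DominatedModel

variable {𝒵 : Type*} [MeasurableSpace 𝒵] (M : DominatedModel 𝒵)

/-- The law `P_θ` of one observation. -/
def law (θ : EllTwo) : Measure 𝒵 := M.ν.withDensity fun z => ENNReal.ofReal (M.pdf θ z)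

/-- The law `P_θ^n` of `n` independent observations. -/
def lawN (n : ℕ) (θ : EllTwo) : Measure (Fin n → 𝒵) := Measure.pi fun _ => M.law θ

/-- `ℓ(θ, z) = log p_θ(z)` as a function of `θ ∈ ℝ^p`. -/
def logLik (p : ℕ) (z : 𝒵) (θ : EuclideanSpace ℝ (Fin p)) : ℝ :=
  Real.log (M.pdf (embedRp p θ) z)

/-- `ℓ_n(θ) = ∑ i, ℓ(θ, Z_i)` as a function of `θ ∈ ℝ^p`. -/
def logLikN (p : ℕ) {n : ℕ} (Z : Fin n → 𝒵) (θ : EuclideanSpace ℝ (Fin p)) : ℝ :=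
  ∑ i, M.logLik p (Z i) θ

/-- `ℓ_n ∈ C²(B)`: on `B` the log-likelihood is finite (no density vanishes at an observation) and
twice continuously differentiable. -/
def LogLikC2On (p : ℕ) {n : ℕ} (Z : Fin n → 𝒵) (B : Set (EuclideanSpace ℝ (Fin p))) : Prop :=
  (∀ θ ∈ B, ∀ i, 0 < M.pdf (embedRp p θ) (Z i)) ∧ ContDiffOn ℝ 2 (M.logLikN p Z) B

end DominatedModel

/-- The Hessian matrix of `f` at `θ`, with derivatives taken within `B` (on a closed ball: the
usual derivatives in the interior, and their continuous extensions at the boundary). -/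
def hessianWithin {p : ℕ} (f : EuclideanSpace ℝ (Fin p) → ℝ) (B : Set (EuclideanSpace ℝ (Fin p)))
    (θ : EuclideanSpace ℝ (Fin p)) : Matrix (Fin p) (Fin p) ℝ :=
  Matrix.of fun i j =>
    fderivWithin ℝ (fun y => fderivWithin ℝ f B y) B θ
      (EuclideanSpace.single i 1) (EuclideanSpace.single j 1)

/-- The smallest eigenvalue of a symmetric real matrix. -/
def lambdaMin {p : ℕ} (A : Matrix (Fin p) (Fin p) ℝ) : ℝ := sInf (spectrum ℝ A)

/-- The operator norm of a matrix with respect to the Euclidean norm. -/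
def matrixOpNorm {p : ℕ} (A : Matrix (Fin p) (Fin p) ℝ) : ℝ :=
  ‖Matrix.toEuclideanCLM (𝕜 := ℝ) A‖

/-- The quadratic form `vᵀ A v`. -/
def quadForm {p : ℕ} (A : Matrix (Fin p) (Fin p) ℝ) (v : EuclideanSpace ℝ (Fin p)) : ℝ :=
  dotProduct v.ofLp (A.mulVec v.ofLp)

namespace DominatedModel

variable {𝒵 : Type*} [MeasurableSpace 𝒵] (M : DominatedModel 𝒵)

/-- Local boundedness and curvature of `ℓ_n` on the ball `B` of radius `η` around `θs`, with all
constants explicit: `ℓ_n ∈ C²(B)` almost surely, and there is an event of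
`P_{θ₀}^n`-probability at least `1 - c' exp(-c n δ²)` on which
`‖∇ℓ_n(θs)‖ ≤ cmax n δ p^κ₁`, `sup_B ‖∇²ℓ_n‖_op ≤ cmax n p^κ₂`, and
`inf_B λ_min(-∇²ℓ_n) ≥ cmin n p^(-κ₃)`. -/
def LocalBoundAndCurvature (n p : ℕ) (θ₀ : EllTwo) (θs : EuclideanSpace ℝ (Fin p))
    (η δ κ₁ κ₂ κ₃ cmin cmax c c' : ℝ) : Prop :=
  (∀ᵐ Z ∂(M.lawN n θ₀), M.LogLikC2On p Z (Metric.closedBall θs η)) ∧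
  ∃ E : Set (Fin n → 𝒵), MeasurableSet E ∧
    1 - c' * Real.exp (-(c * n * δ ^ 2)) ≤ (M.lawN n θ₀).real E ∧
    ∀ Z ∈ E,
      ‖gradientWithin (M.logLikN p Z) (Metric.closedBall θs η) θs‖
          ≤ cmax * n * δ * (p : ℝ) ^ κ₁ ∧
      (∀ θ ∈ Metric.closedBall θs η,
        matrixOpNorm (hessianWithin (M.logLikN p Z) (Metric.closedBall θs η) θ)
          ≤ cmax * n * (p : ℝ) ^ κ₂) ∧
      (∀ θ ∈ Metric.closedBall θs η,
        cmin * n * (p : ℝ) ^ (-κ₃)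
          ≤ lambdaMin (-(hessianWithin (M.logLikN p Z) (Metric.closedBall θs η) θ)))

/-- The growth conditions on `p`, `η` and `δ_n`. -/
def GrowthConditions (n p : ℕ) (η δ κ₂ κ₃ κ₄ C : ℝ) : Prop :=
  (p : ℝ) ≤ C * n * δ ^ 2 ∧
  C * max (δ * (p : ℝ) ^ κ₂) (max (η * δ * (p : ℝ) ^ κ₄) (δ ^ 2 * (p : ℝ) ^ κ₄)) * Real.log n
    ≤ (p : ℝ) ^ (-κ₃)

/-- Local mean boundedness: the mean of the score and the Bernstein-type moment bounds on gradient,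
Hessian and Hessian increments of `ℓ(·, Z)`, `Z ∼ P_{θ₀}`. -/
def LocalMeanBoundedness (p : ℕ) (θ₀ : EllTwo) (θs : EuclideanSpace ℝ (Fin p))
    (η δ κ₁ κ₂ κ₄ C₁ : ℝ) : Prop :=
  ∀ v : EuclideanSpace ℝ (Fin p), ‖v‖ ≤ 1 →
    |∫ z, inner ℝ v (gradientWithin (M.logLik p z) (Metric.closedBall θs η) θs) ∂(M.law θ₀)|
        ≤ C₁ * δ * (p : ℝ) ^ κ₁ ∧
    ∀ q : ℕ, 2 ≤ q →
      (∫⁻ z, ENNReal.ofReal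
          (|inner ℝ v (gradientWithin (M.logLik p z) (Metric.closedBall θs η) θs)| ^ q)
          ∂(M.law θ₀)
        ≤ ENNReal.ofReal ((q.factorial / 2 : ℝ) * C₁ ^ q *
            (p : ℝ) ^ (2 * κ₁ + ((q : ℝ) - 2) * κ₂))) ∧
      (∀ θ ∈ Metric.closedBall θs η,
        ∫⁻ z, ENNReal.ofReal
          (|quadForm (hessianWithin (M.logLik p z) (Metric.closedBall θs η) θ) v| ^ q)
          ∂(M.law θ₀)
        ≤ ENNReal.ofReal ((q.factorial / 2 : ℝ) * C₁ ^ q *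
            (p : ℝ) ^ (2 * κ₂ + ((q : ℝ) - 2) * κ₄))) ∧
      (∀ θ ∈ Metric.closedBall θs η, ∀ θ' ∈ Metric.closedBall θs η,
        ∫⁻ z, ENNReal.ofReal
          (|quadForm (hessianWithin (M.logLik p z) (Metric.closedBall θs η) θ
              - hessianWithin (M.logLik p z) (Metric.closedBall θs η) θ') v| ^ q)
          ∂(M.law θ₀)
        ≤ ENNReal.ofReal ((q.factorial / 2 : ℝ) *
            (C₁ * (p : ℝ) ^ κ₄ * ‖θ - θ'‖) ^ q))

/-- Local mean curvature: `inf_B λ_min(E_{θ₀}[-∇²ℓ(θ, Z)]) ≥ C₂ p^(-κ₃)`, the expectation of a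
matrix being taken entrywise. -/
def LocalMeanCurvature (p : ℕ) (θ₀ : EllTwo) (θs : EuclideanSpace ℝ (Fin p))
    (η κ₃ C₂ : ℝ) : Prop :=
  ∀ θ ∈ Metric.closedBall θs η,
    C₂ * (p : ℝ) ^ (-κ₃) ≤ lambdaMin (Matrix.of fun i j =>
      ∫ z, (-(hessianWithin (M.logLik p z) (Metric.closedBall θs η) θ)) i j ∂(M.law θ₀))

end DominatedModel

end

/-! ### Finite nets in Euclidean balls -/

/-! All three bounds compare a sum of n independent terms with its mean, uniformly over directions v
and, for the Hessian, over the ball. The moment hypotheses are Bernstein conditions, so centred sums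
have subexponential tails (`measure_abs_sum_gt_le`). A 1/4-net of at most 25^p directions controls
norms up to a factor 2 (`norm_le_of_net`, `matrixOpNorm_le_of_net`). Since p ≤ C n δ², a failure
probability of order exp(-5Cnδ²) per direction survives the union bound (`exists_deviation_event`).

For a fixed direction, Hessian increments satisfy Bernstein conditions with both parameters
proportional to the distance. Dyadic chaining (`measure_exists_chaining_le`) then gives oscillations
of order n δ η p^κ₄ over the ball. With the fluctuation at the centre, of order n max(δ p^κ₂, δ²
p^κ₄), the Hessian is within O(n w) of its mean, w being the maximum in the growth condition. That
condition reads C w log n ≤ p^(-κ₃), so for large n the deviation is at most half the mean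
curvature, and the other half survives (`localBoundAndCurvature_of_le_log`). The upper bounds add
the sizes of the means. The finitely many remaining n are absorbed into C'.

Smoothness is assumed only for the sum ℓ_n, the moment bounds only for one observation;
`ae_mem_of_ae_sum_mem` bridges the two. -/

theorem exists_finset_cover_of_subset_closedBall {E : Type*} [NormedAddCommGroup E]
    [NormedSpace ℝ E] [FiniteDimensional ℝ E] (S : Set E) (x : E) {r : ℝ} (hr : 0 < r)
    (hS : S ⊆ Metric.closedBall x (2 * r)) :
    ∃ T : Finset E, (T : Set E) ⊆ S ∧ T.card ≤ 5 ^ Module.finrank ℝ E ∧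
      ∀ y ∈ S, ∃ t ∈ T, ‖y - t‖ ≤ r := by
  classical
  -- Packing bound: rescaling by 1/r about x gives 1-separated points of norm at most 2.
  have hcard : ∀ T : Finset E, (T : Set E) ⊆ S → (∀ c ∈ T, ∀ d ∈ T, c ≠ d → r ≤ ‖c - d‖) →
      T.card ≤ 5 ^ Module.finrank ℝ E := by
    intro T hT hsep
    have hinj : Function.Injective fun y : E => r⁻¹ • (y - x) := fun a b hab => by
      have := smul_right_injective E (inv_ne_zero hr.ne') hab
      exact sub_left_injective this
    rw [← Finset.card_image_of_injective T hinj]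
    refine Besicovitch.card_le_of_separated _ ?_ ?_
    · intro c hc
      obtain ⟨y, hy, rfl⟩ := Finset.mem_image.mp hc
      have := hS (hT hy)
      rw [Metric.mem_closedBall, dist_eq_norm] at this
      rw [norm_smul, Real.norm_eq_abs, abs_of_pos (inv_pos.mpr hr), inv_mul_le_iff₀ hr]
      linarith
    · intro c hc d hd hcd
      obtain ⟨y, hy, rfl⟩ := Finset.mem_image.mp hc
      obtain ⟨z, hz, rfl⟩ := Finset.mem_image.mp hd
      have hyz : y ≠ z := fun h => hcd (by rw [h])
      rw [← smul_sub, sub_sub_sub_cancel_right, norm_smul, Real.norm_eq_abs,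
        abs_of_pos (inv_pos.mpr hr), le_inv_mul_iff₀ hr, mul_one]
      exact hsep y hy z hz hyz
  -- Without a net, every separated set could be enlarged by a point it misses, so separated sets of
  -- all sizes would exist.
  by_contra! hno
  have key : ∀ m : ℕ, ∃ T : Finset E, (T : Set E) ⊆ S ∧
      (∀ c ∈ T, ∀ d ∈ T, c ≠ d → r ≤ ‖c - d‖) ∧ T.card = m := by
    intro m
    induction m with
    | zero => exact ⟨∅, by simp, by simp, rfl⟩
    | succ m ih =>
      obtain ⟨T, hT, hsep, hm⟩ := ih
      obtain ⟨y, hy, hyT⟩ := hno T hT (hcard T hT hsep)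
      have hyn : y ∉ T := fun h => by
        have := hyT y h
        rw [sub_self, norm_zero] at this
        linarith
      refine ⟨insert y T, ?_, ?_, by rw [Finset.card_insert_of_notMem hyn, hm]⟩
      · rw [Finset.coe_insert]
        exact Set.insert_subset hy hT
      · intro c hc d hd hcd
        rcases Finset.mem_insert.mp hc with hc' | hc' <;>
          rcases Finset.mem_insert.mp hd with hd' | hd'
        · exact absurd (hc'.trans hd'.symm) hcd
        · rw [hc']
          exact (hyT d hd').le
        · rw [hd', norm_sub_rev]
          exact (hyT c hc').le
        · exact hsep c hc' d hd' hcd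
  obtain ⟨T, hT, hsep, hm⟩ := key (5 ^ Module.finrank ℝ E + 1)
  have := hcard T hT hsep
  omega

/-- Halving the scale by refining around each net point costs a factor 5^dim per level. Starting
from the centre alone lets a chain begin at x. -/
theorem exists_dyadic_nets_closedBall {E : Type*} [NormedAddCommGroup E]
    [NormedSpace ℝ E] [FiniteDimensional ℝ E] (x : E) {r : ℝ} (hr : 0 < r) :
    ∃ N : ℕ → Finset E, N 0 = {x} ∧ ∀ k, (N k : Set E) ⊆ Metric.closedBall x r ∧
      (N k).card ≤ 5 ^ (k * Module.finrank ℝ E) ∧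
      ∀ y ∈ Metric.closedBall x r, ∃ t ∈ N k, ‖y - t‖ ≤ r / 2 ^ k := by
  classical
  have h := fun (k : ℕ) (y : E) => exists_finset_cover_of_subset_closedBall
    (Metric.closedBall x r ∩ Metric.closedBall y (2 * (r / 2 ^ (k + 1)))) y
    (r := r / 2 ^ (k + 1)) (by positivity) Set.inter_subset_right
  choose T hT hTc hTn using h
  let N : ℕ → Finset E := fun k => Nat.rec {x} (fun k s => s.biUnion (T k)) k
  have hN : ∀ k, N (k + 1) = (N k).biUnion (T k) := fun k => rfl
  refine ⟨N, rfl, fun k => ?_⟩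
  induction k with
  | zero =>
    refine ⟨by simp [N, hr.le], by simp [N], fun y hy => ⟨x, by simp [N], ?_⟩⟩
    simpa [dist_eq_norm] using hy
  | succ k ih =>
    obtain ⟨h1, h2, h3⟩ := ih
    rw [hN]
    refine ⟨?_, ?_, ?_⟩
    · intro y hy
      obtain ⟨t, -, ht⟩ := Finset.mem_biUnion.mp hy
      exact (hT k t ht).1
    · refine (Finset.card_biUnion_le_card_mul _ _ _ fun t _ => hTc k t).trans ?_
      rw [add_mul, pow_add, one_mul]
      exact Nat.mul_le_mul_right _ h2
    · intro y hy
      obtain ⟨t, ht, hyt⟩ := h3 y hy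
      obtain ⟨s, hs, hys⟩ := hTn k t y ⟨hy, by
        rw [Metric.mem_closedBall, dist_eq_norm]
        refine hyt.trans (le_of_eq ?_)
        rw [pow_succ]
        field_simp⟩
      exact ⟨s, Finset.mem_biUnion.mpr ⟨t, ht, hs⟩, hys⟩

/-! ### A Bernstein inequality under moment conditions -/

theorem hasSum_pow_add_two_div_factorial (x : ℝ) :
    HasSum (fun q : ℕ => x ^ (q + 2) / (q + 2).factorial) (Real.exp x - 1 - x) := by
  have h : HasSum (fun q : ℕ => x ^ q / q.factorial) (Real.exp x) := by
    rw [Real.exp_eq_exp_ℝ]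
    exact NormedSpace.expSeries_div_hasSum_exp x
  have := (hasSum_nat_add_iff' 2).mpr h
  simpa [Finset.sum_range_succ, sub_sub] using this

theorem abs_exp_sub_one_sub_le (x : ℝ) :
    |Real.exp x - 1 - x| ≤ Real.exp |x| - 1 - |x| := by
  have h1 := hasSum_pow_add_two_div_factorial x
  have h2 := hasSum_pow_add_two_div_factorial |x|
  rw [← h1.tsum_eq, ← h2.tsum_eq]
  have h3 : ∀ q : ℕ, ‖x ^ (q + 2) / ((q + 2).factorial : ℝ)‖ =
      |x| ^ (q + 2) / (q + 2).factorial := fun q => by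
    rw [Real.norm_eq_abs, abs_div, abs_pow, Nat.abs_cast]
  rw [← Real.norm_eq_abs, ← tsum_congr h3]
  exact norm_tsum_le_tsum_norm ((summable_congr h3).mpr h2.summable)

/-- The Bernstein moment condition: `E|X|^q ≤ (q!/2) σ² b^(q-2)` for all `q ≥ 2`. -/
def BernsteinMoments {Ω : Type*} [MeasurableSpace Ω] (P : Measure Ω) (X : Ω → ℝ) (σ b : ℝ) :
    Prop :=
  ∀ q : ℕ, ∫⁻ z, ENNReal.ofReal (|X z| ^ (q + 2)) ∂P ≤
    ENNReal.ofReal ((q + 2).factorial / 2 * (σ ^ 2 * b ^ q))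

namespace BernsteinMoments

variable {Ω : Type*} [MeasurableSpace Ω] {P : Measure Ω} {X : Ω → ℝ} {σ b : ℝ}

/-- Integrating the exponential series termwise cancels the factorials and leaves a geometric series
of ratio |l| b ≤ 1/2, hence with a factor at most 2. -/
theorem lintegral_exp_le (h : BernsteinMoments P X σ b) (hX : AEMeasurable X P) (hb : 0 ≤ b)
    {l : ℝ} (hl : |l| * b ≤ 1 / 2) :
    ∫⁻ z, ENNReal.ofReal (Real.exp |l * X z| - 1 - |l * X z|) ∂P ≤
      ENNReal.ofReal (l ^ 2 * σ ^ 2) := by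
  have hgeo : HasSum (fun q : ℕ => l ^ 2 * σ ^ 2 / 2 * (|l| * b) ^ q)
      (l ^ 2 * σ ^ 2 / 2 * (1 - |l| * b)⁻¹) :=
    (hasSum_geometric_of_lt_one (by positivity) (by linarith)).mul_left _
  calc ∫⁻ z, ENNReal.ofReal (Real.exp |l * X z| - 1 - |l * X z|) ∂P
      = ∫⁻ z, ∑' q : ℕ, ENNReal.ofReal (|l| ^ (q + 2) / (q + 2).factorial) *
          ENNReal.ofReal (|X z| ^ (q + 2)) ∂P := by
        refine lintegral_congr fun z => ?_
        have hs := hasSum_pow_add_two_div_factorial |l * X z|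
        rw [← hs.tsum_eq, ENNReal.ofReal_tsum_of_nonneg (fun q => by positivity) hs.summable]
        refine tsum_congr fun q => ?_
        rw [← ENNReal.ofReal_mul (by positivity), abs_mul, mul_pow]
        congr 1
        ring
    _ = ∑' q : ℕ, ENNReal.ofReal (|l| ^ (q + 2) / (q + 2).factorial) *
          ∫⁻ z, ENNReal.ofReal (|X z| ^ (q + 2)) ∂P := by
        rw [lintegral_tsum fun q => by fun_prop]
        refine tsum_congr fun q => ?_
        rw [lintegral_const_mul'' _ (by fun_prop)]
    _ ≤ ∑' q : ℕ, ENNReal.ofReal (l ^ 2 * σ ^ 2 / 2 * (|l| * b) ^ q) := by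
        refine ENNReal.tsum_le_tsum fun q => ?_
        refine (mul_le_mul_right (h q) _).trans (le_of_eq ?_)
        rw [← ENNReal.ofReal_mul (by positivity)]
        congr 1
        have : ((q + 2).factorial : ℝ) ≠ 0 := by positivity
        rw [← sq_abs l, mul_pow, pow_add]
        field_simp
    _ = ENNReal.ofReal (l ^ 2 * σ ^ 2 / 2 * (1 - |l| * b)⁻¹) := by
        rw [← hgeo.tsum_eq, ENNReal.ofReal_tsum_of_nonneg (fun q => by positivity) hgeo.summable]
    _ ≤ ENNReal.ofReal (l ^ 2 * σ ^ 2) := by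
        refine ENNReal.ofReal_le_ofReal ?_
        have h1 : (1 - |l| * b)⁻¹ ≤ 2 := by
          rw [inv_le_comm₀ (by linarith) (by norm_num)]
          linarith
        nlinarith [mul_nonneg (sq_nonneg l) (sq_nonneg σ)]

theorem lintegral_sq_le (h : BernsteinMoments P X σ b) :
    ∫⁻ z, ENNReal.ofReal (X z ^ 2) ∂P ≤ ENNReal.ofReal (σ ^ 2) := by
  have := h 0
  simpa using this

theorem memLp_two (h : BernsteinMoments P X σ b) (hX : AEMeasurable X P) : MemLp X 2 P := by
  rw [memLp_two_iff_integrable_sq hX.aestronglyMeasurable]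
  refine ⟨(hX.pow_const 2).aestronglyMeasurable, ?_⟩
  rw [hasFiniteIntegral_iff_ofReal (ae_of_all _ fun z => sq_nonneg (X z))]
  exact h.lintegral_sq_le.trans_lt ENNReal.ofReal_lt_top

variable [IsProbabilityMeasure P]

theorem integrable (h : BernsteinMoments P X σ b) (hX : AEMeasurable X P) : Integrable X P :=
  (h.memLp_two hX).integrable (by norm_num)

theorem abs_integral_le (h : BernsteinMoments P X σ b) (hX : AEMeasurable X P) (hσ : 0 ≤ σ) :
    |∫ z, X z ∂P| ≤ σ := by
  have hsq : ∫ z, X z ^ 2 ∂P ≤ σ ^ 2 := by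
    rw [integral_eq_lintegral_of_nonneg_ae (ae_of_all _ fun z => sq_nonneg (X z))
      (hX.pow_const 2).aestronglyMeasurable]
    exact ENNReal.toReal_le_of_le_ofReal (sq_nonneg σ) h.lintegral_sq_le
  have hvar := ProbabilityTheory.variance_nonneg X P
  rw [ProbabilityTheory.variance_eq_sub (h.memLp_two hX)] at hvar
  refine abs_le_of_sq_le_sq ?_ hσ
  have : ∫ z, (X ^ 2) z ∂P = ∫ z, X z ^ 2 ∂P := rfl
  linarith

/-- The linear part of the exponential integrates to the mean, the remainder to at most l²σ², and 1
+ x ≤ exp x turns this into a sub-Gaussian bound for small l. -/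
theorem integrable_exp (h : BernsteinMoments P X σ b) (hX : AEMeasurable X P) (hb : 0 ≤ b)
    {l : ℝ} (hl : |l| * b ≤ 1 / 2) :
    Integrable (fun z => Real.exp (l * X z)) P ∧
      ∫ z, Real.exp (l * X z) ∂P ≤ Real.exp (l * ∫ z, X z ∂P + l ^ 2 * σ ^ 2) := by
  have hlin := h.lintegral_exp_le hX hb hl
  have hnn : ∀ z, 0 ≤ Real.exp |l * X z| - 1 - |l * X z| := fun z =>
    (abs_nonneg _).trans (abs_exp_sub_one_sub_le _)
  have hmeas : AEMeasurable (fun z => Real.exp |l * X z| - 1 - |l * X z|) P := by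
    have h1 : AEMeasurable (fun z => |l * X z|) P := by fun_prop
    exact (h1.exp.sub_const 1).sub h1
  have hdom : Integrable (fun z => Real.exp |l * X z| - 1 - |l * X z|) P := by
    refine ⟨hmeas.aestronglyMeasurable, ?_⟩
    rw [hasFiniteIntegral_iff_ofReal (ae_of_all _ hnn)]
    exact hlin.trans_lt ENNReal.ofReal_lt_top
  have hlX : Integrable (fun z => l * X z) P := (h.integrable hX).const_mul l
  have hg : Integrable (fun z => Real.exp (l * X z) - 1 - l * X z) P := by
    refine hdom.mono' ?_ (ae_of_all _ fun z => abs_exp_sub_one_sub_le _)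
    exact (((hX.const_mul l).exp.sub_const 1).sub (hX.const_mul l)).aestronglyMeasurable
  have hsum : Integrable (fun z => (Real.exp (l * X z) - 1 - l * X z) + (1 + l * X z)) P :=
    hg.add ((integrable_const 1).add hlX)
  have heq : ∀ z, (Real.exp (l * X z) - 1 - l * X z) + (1 + l * X z) = Real.exp (l * X z) :=
    fun z => by ring
  simp_rw [heq] at hsum
  refine ⟨hsum, ?_⟩
  have hle : ∫ z, (Real.exp (l * X z) - 1 - l * X z) ∂P ≤ l ^ 2 * σ ^ 2 := by
    refine (integral_mono hg hdom fun z => (le_abs_self _).trans (abs_exp_sub_one_sub_le _)).trans ?_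
    rw [integral_eq_lintegral_of_nonneg_ae (ae_of_all _ hnn) hmeas.aestronglyMeasurable]
    exact ENNReal.toReal_le_of_le_ofReal (by positivity) hlin
  have hcalc : ∫ z, Real.exp (l * X z) ∂P =
      ∫ z, (Real.exp (l * X z) - 1 - l * X z) ∂P + (1 + l * ∫ z, X z ∂P) := by
    rw [← integral_const_mul]
    have h1 : ∫ _z, (1 : ℝ) ∂P = 1 := by simp
    have h2 : 1 + ∫ z, l * X z ∂P = ∫ z, (1 + l * X z) ∂P := by
      rw [integral_add (integrable_const 1) hlX, h1]
    rw [h2, ← integral_add (g := fun z => 1 + l * X z) hg ((integrable_const 1).add hlX)]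
    exact integral_congr_ae (ae_of_all _ fun z => (heq z).symm)
  rw [hcalc]
  have := Real.add_one_le_exp (l * ∫ z, X z ∂P + l ^ 2 * σ ^ 2)
  linarith

/-- Chernoff's bound with the parameter l left free for each application to tune; the sign s serves
both tails. -/
theorem measure_sum_ge_le (h : BernsteinMoments P X σ b) (hX : AEMeasurable X P) (hb : 0 ≤ b)
    (n : ℕ) {l : ℝ} (hl0 : 0 ≤ l) (hl : l * b ≤ 1 / 2) (s : ℝ) (hs : |s| = 1) (t : ℝ) :
    (Measure.pi fun _ : Fin n => P).real
        {Z | t ≤ s * ∑ i, (X (Z i) - ∫ z, X z ∂P)} ≤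
      Real.exp (-(l * t) + n * (l ^ 2 * σ ^ 2)) := by
  set μ := ∫ z, X z ∂P with hμ
  have hs2 : s ^ 2 = 1 := by rw [← sq_abs, hs]; norm_num
  have hls : |l * s| * b ≤ 1 / 2 := by rwa [abs_mul, hs, mul_one, abs_of_nonneg hl0]
  obtain ⟨hint, hle⟩ := h.integrable_exp hX hb hls
  rw [← hμ] at hle
  have hexp : ∀ z, Real.exp (l * (s * (X z - μ))) =
      Real.exp (-(l * s * μ)) * Real.exp (l * s * X z) := fun z => by
    rw [← Real.exp_add]
    congr 1
    ring
  have hint0 : Integrable (fun z => Real.exp (l * (s * (X z - μ)))) P := by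
    simp_rw [hexp]
    exact hint.const_mul _
  have hle0 : ∫ z, Real.exp (l * (s * (X z - μ))) ∂P ≤ Real.exp (l ^ 2 * σ ^ 2) := by
    simp_rw [hexp]
    rw [integral_const_mul]
    refine (mul_le_mul_of_nonneg_left hle (Real.exp_nonneg _)).trans (le_of_eq ?_)
    rw [← Real.exp_add, mul_pow, hs2]
    congr 1
    ring
  have hprod : ∀ Z : Fin n → Ω, Real.exp (l * (s * ∑ i, (X (Z i) - μ))) =
      ∏ i, Real.exp (l * (s * (X (Z i) - μ))) := fun Z => by
    rw [← Real.exp_sum, Finset.mul_sum, Finset.mul_sum]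
  have hintS : Integrable (fun Z : Fin n → Ω => Real.exp (l * (s * ∑ i, (X (Z i) - μ))))
      (Measure.pi fun _ : Fin n => P) := by
    simp_rw [hprod]
    exact Integrable.fintype_prod (f := fun (_ : Fin n) z => Real.exp (l * (s * (X z - μ))))
      fun _ => hint0
  refine (ProbabilityTheory.measure_ge_le_exp_mul_mgf t hl0 hintS).trans ?_
  rw [ProbabilityTheory.mgf]
  simp_rw [hprod]
  rw [integral_fintype_prod_eq_prod fun (_ : Fin n) z => Real.exp (l * (s * (X z - μ))),
    Finset.prod_const, Finset.card_univ, Fintype.card_fin]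
  refine (mul_le_mul_of_nonneg_left (pow_le_pow_left₀
    (integral_nonneg fun z => (Real.exp_pos _).le) hle0 n) (Real.exp_nonneg _)).trans ?_
  rw [← Real.exp_nat_mul, ← Real.exp_add]
  refine le_of_eq ?_
  congr 1
  ring

theorem measure_abs_sum_gt_le (h : BernsteinMoments P X σ b) (hX : AEMeasurable X P) (hb : 0 ≤ b)
    (n : ℕ) {l : ℝ} (hl0 : 0 ≤ l) (hl : l * b ≤ 1 / 2) (t : ℝ) :
    (Measure.pi fun _ : Fin n => P).real
        {Z | t < |∑ i, (X (Z i) - ∫ z, X z ∂P)|} ≤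
      2 * Real.exp (-(l * t) + n * (l ^ 2 * σ ^ 2)) := by
  have h1 := h.measure_sum_ge_le hX hb n hl0 hl 1 (by simp) t
  have h2 := h.measure_sum_ge_le hX hb n hl0 hl (-1) (by simp) t
  have hsub : {Z : Fin n → Ω | t < |∑ i, (X (Z i) - ∫ z, X z ∂P)|} ⊆
      {Z | t ≤ 1 * ∑ i, (X (Z i) - ∫ z, X z ∂P)} ∪
      {Z | t ≤ (-1) * ∑ i, (X (Z i) - ∫ z, X z ∂P)} := by
    intro Z hZ
    rcases lt_abs.mp (Set.mem_ofPred_eq ▸ hZ) with hZ | hZ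
    · left
      change t ≤ 1 * _
      linarith
    · right
      change t ≤ (-1) * _
      linarith
  refine (measureReal_mono hsub).trans ((measureReal_union_le _ _).trans ?_)
  linarith

end BernsteinMoments

/-! ### Dyadic chaining -/

theorem sum_range_succ_div_two_pow_le (m : ℕ) :
    ∑ k ∈ Finset.range m, ((k : ℝ) + 1) / 2 ^ k ≤ 4 := by
  have h : ∑ k ∈ Finset.range m, ((k : ℝ) + 1) / 2 ^ k = 4 - 2 * (m + 2) / 2 ^ m := by
    induction m with
    | zero => norm_num
    | succ m ih =>
      rw [Finset.sum_range_succ, ih, pow_succ]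
      push_cast
      field_simp
      ring
  rw [h]
  have : (0 : ℝ) ≤ 2 * (m + 2) / 2 ^ m := by positivity
  linarith

/-- Telescope along net points approximating y at successive scales: the increments sum to at most
4a, and continuity passes to the limit. The factor k + 1 gives the slack that beats the growth of
the nets. -/
theorem abs_sub_le_of_dyadic_increments {E : Type*} [NormedAddCommGroup E] {x : E} {r : ℝ}
    (N : ℕ → Finset E) (hN0 : N 0 = {x}) (hNB : ∀ k, (N k : Set E) ⊆ Metric.closedBall x r)
    (hN : ∀ k, ∀ y ∈ Metric.closedBall x r, ∃ t ∈ N k, ‖y - t‖ ≤ r / 2 ^ k)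
    (hr : 0 < r) {F : E → ℝ} (hF : ContinuousOn F (Metric.closedBall x r)) {a : ℝ} (ha : 0 ≤ a)
    (hinc : ∀ k, ∀ s ∈ N k, ∀ t ∈ N (k + 1), ‖t - s‖ ≤ 2 * r / 2 ^ k →
      |F t - F s| ≤ a * ((k + 1) / 2 ^ k))
    {y : E} (hy : y ∈ Metric.closedBall x r) : |F y - F x| ≤ 4 * a := by
  choose u huN hu using fun k => hN k y hy
  have hu0 : u 0 = x := by simpa [hN0] using huN 0
  have hstep : ∀ m, |F (u m) - F x| ≤ ∑ k ∈ Finset.range m, a * (((k : ℝ) + 1) / 2 ^ k) := by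
    intro m
    induction m with
    | zero => simp [hu0]
    | succ m ih =>
      rw [Finset.sum_range_succ]
      have h1 : ‖u (m + 1) - u m‖ ≤ 2 * r / 2 ^ m := by
        have h2 : u (m + 1) - u m = (y - u m) - (y - u (m + 1)) := by abel
        have h3 : r / 2 ^ (m + 1) ≤ r / 2 ^ m := by
          gcongr
          · norm_num
          · omega
        rw [h2]
        refine (norm_sub_le _ _).trans ((add_le_add (hu m) ((hu (m + 1)).trans h3)).trans ?_)
        rw [← two_mul, mul_div_assoc]
      have h4 := hinc m (u m) (huN m) (u (m + 1)) (huN (m + 1)) h1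
      have h5 : F (u (m + 1)) - F x = (F (u (m + 1)) - F (u m)) + (F (u m) - F x) := by ring
      rw [h5]
      exact (abs_add_le _ _).trans (by linarith)
  have hbound : ∀ m, |F (u m) - F x| ≤ 4 * a := fun m => by
    refine (hstep m).trans ?_
    rw [← Finset.mul_sum, mul_comm 4 a]
    exact mul_le_mul_of_nonneg_left (sum_range_succ_div_two_pow_le m) ha
  have hlim : Filter.Tendsto u Filter.atTop (nhds y) := by
    rw [tendsto_iff_norm_sub_tendsto_zero]
    refine squeeze_zero (fun _ => norm_nonneg _) (fun k => (norm_sub_rev _ _).trans_le (hu k)) ?_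
    have := (tendsto_pow_atTop_nhds_zero_of_lt_one (r := (1 / 2 : ℝ)) (by norm_num)
      (by norm_num)).const_mul r
    simpa [div_eq_mul_inv] using this
  have hlimF : Filter.Tendsto (fun k => F (u k)) Filter.atTop (nhds (F y)) :=
    (hF y hy).tendsto.comp (tendsto_nhdsWithin_iff.mpr
      ⟨hlim, Filter.Eventually.of_forall fun k => hNB k (huN k)⟩)
  exact le_of_tendsto (hlimF.sub_const (F x)).abs (Filter.Eventually.of_forall hbound)

theorem BernsteinMoments.mono {Ω : Type*} [MeasurableSpace Ω] {P : Measure Ω} {X : Ω → ℝ}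
    {σ b σ' b' : ℝ} (h : BernsteinMoments P X σ b) (hσ : 0 ≤ σ) (hb : 0 ≤ b) (hσ' : σ ≤ σ')
    (hb' : b ≤ b') : BernsteinMoments P X σ' b' := fun q =>
  (h q).trans (ENNReal.ofReal_le_ofReal (by gcongr))

theorem five_pow_le_exp (k : ℕ) : (5 : ℝ) ^ k ≤ Real.exp (2 * k) := by
  have h : (5 : ℝ) ≤ Real.exp 2 := by
    have h1 := Real.exp_one_gt_d9
    have h2 : Real.exp 2 = Real.exp 1 * Real.exp 1 := by
      rw [← Real.exp_add]
      norm_num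
    rw [h2]
    nlinarith
  rw [mul_comm, Real.exp_nat_mul]
  exact pow_le_pow_left₀ (by norm_num) h k

/-- Uniform deviation over a ball for empirical processes with subexponential increments. -/
theorem measure_exists_chaining_le {E : Type*} [NormedAddCommGroup E] [NormedSpace ℝ E]
    [FiniteDimensional ℝ E] {Ω : Type*} [MeasurableSpace Ω] {P : Measure Ω}
    [IsProbabilityMeasure P] {Y : E → Ω → ℝ} {x : E} {r D : ℝ} (hr : 0 < r) (hD : 0 < D)
    (hYm : ∀ y ∈ Metric.closedBall x r, AEMeasurable (Y y) P)
    (hYi : ∀ y ∈ Metric.closedBall x r, Integrable (Y y) P)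
    (hY : ∀ y ∈ Metric.closedBall x r, ∀ y' ∈ Metric.closedBall x r,
      BernsteinMoments P (fun z => Y y z - Y y' z) (D * ‖y - y'‖) (D * ‖y - y'‖))
    (n : ℕ) {d C L : ℝ} (hd : 0 < d) (hd1 : d ≤ 1)
    (hp : (Module.finrank ℝ E : ℝ) ≤ C * n * d ^ 2) (hL : 1 ≤ L * n * d ^ 2) (hC : 0 ≤ C)
    (hL0 : 0 ≤ L) :
    Measure.pi (fun _ : Fin n => P)
        {Z | ContinuousOn (fun y => ∑ i, Y y (Z i)) (Metric.closedBall x r) ∧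
          ∃ y ∈ Metric.closedBall x r, 8 * (8 * C + 2 * L + 1 / 2) * n * d * D * r <
            |∑ i, (Y y (Z i) - ∫ z, Y y z ∂P) - ∑ i, (Y x (Z i) - ∫ z, Y x z ∂P)|} ≤
      ENNReal.ofReal (4 * Real.exp (-(L * n * d ^ 2))) := by
  classical
  obtain ⟨N, hN0, hN⟩ := exists_dyadic_nets_closedBall x hr
  set B := Metric.closedBall x r with hB
  -- Chosen so that T/2 - 1/4 = 4C + L: 4C pays for the pairs of net points at each level, and L is
  -- the remaining decay.
  set T := 8 * C + 2 * L + 1 / 2 with hT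
  have hTpos : 0 < T := by positivity
  set Q := Measure.pi (fun _ : Fin n => P) with hQ
  let F : (Fin n → Ω) → E → ℝ := fun Z y => ∑ i, (Y y (Z i) - ∫ z, Y y z ∂P)
  let a : ℝ := 2 * T * n * d * D * r
  let bad : ℕ → Set (Fin n → Ω) := fun k =>
    ⋃ e ∈ (N (k + 1) ×ˢ N k).filter fun e => ‖e.1 - e.2‖ ≤ 2 * r / 2 ^ k,
      {Z | a * ((k + 1) / 2 ^ k) < |F Z e.1 - F Z e.2|}
  have hLip : ∀ y ∈ B, ∀ y' ∈ B, |∫ z, Y y z ∂P - ∫ z, Y y' z ∂P| ≤ D * ‖y - y'‖ := by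
    intro y hy y' hy'
    rw [← integral_sub (hYi y hy) (hYi y' hy')]
    exact (hY y hy y' hy').abs_integral_le ((hYm y hy).sub (hYm y' hy')) (by positivity)
  have hEcont : ContinuousOn (fun y => ∫ z, Y y z ∂P) B := by
    refine LipschitzOnWith.continuousOn (K := D.toNNReal) ?_
    refine LipschitzOnWith.of_dist_le_mul fun y hy y' hy' => ?_
    rw [Real.dist_eq, dist_eq_norm, Real.coe_toNNReal _ hD.le]
    exact hLip y hy y' hy'
  -- The left-hand event need not be measurable; it is only covered by countably many bad
  -- increments.
  have hsub : {Z : Fin n → Ω | ContinuousOn (fun y => ∑ i, Y y (Z i)) B ∧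
      ∃ y ∈ B, 8 * T * n * d * D * r < |F Z y - F Z x|} ⊆ ⋃ k, bad k := by
    rintro Z ⟨hZc, y, hy, hlt⟩
    by_contra hZ
    have hgood : ∀ k, ∀ s ∈ N k, ∀ t ∈ N (k + 1), ‖t - s‖ ≤ 2 * r / 2 ^ k →
        |F Z t - F Z s| ≤ a * ((k + 1) / 2 ^ k) := by
      intro k s hs t ht hts
      by_contra! hlt
      refine hZ (Set.mem_iUnion.mpr ⟨k, Set.mem_iUnion₂.mpr ⟨(t, s), ?_, hlt⟩⟩)
      exact Finset.mem_filter.mpr ⟨Finset.mk_mem_product ht hs, hts⟩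
    have hFc : ContinuousOn (F Z) B := by
      have : F Z = fun y => ∑ i, Y y (Z i) - n * ∫ z, Y y z ∂P := by
        funext y
        simp [F]
      rw [this]
      exact hZc.sub (continuousOn_const.mul hEcont)
    have := abs_sub_le_of_dyadic_increments N hN0 (fun k => (hN k).1) (fun k => (hN k).2.2) hr hFc
      (a := a) (by positivity) hgood hy
    have h4a : 4 * a = 8 * T * n * d * D * r := by
      simp only [a]
      ring
    linarith
  set ρ := Real.exp (-(L * n * d ^ 2)) with hρ
  have hρ0 : 0 < ρ := Real.exp_pos _
  have hρ2 : ρ ≤ 1 / 2 := by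
    refine (Real.exp_le_exp.mpr (neg_le_neg hL)).trans ?_
    rw [Real.exp_neg, one_div]
    refine inv_anti₀ (by norm_num) ?_
    have := Real.add_one_le_exp (1 : ℝ)
    linarith
  have hbad : ∀ k, Q (bad k) ≤ ENNReal.ofReal (2 * ρ * ρ ^ k) := by
    intro k
    have hedge : ∀ e ∈ (N (k + 1) ×ˢ N k).filter fun e => ‖e.1 - e.2‖ ≤ 2 * r / 2 ^ k,
        Q {Z | a * ((k + 1) / 2 ^ k) < |F Z e.1 - F Z e.2|} ≤
          ENNReal.ofReal (2 * Real.exp (-((T / 2 - 1 / 4) * (k + 1) * (n * d ^ 2)))) := by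
      rintro ⟨t, s⟩ he
      obtain ⟨he, hts⟩ := Finset.mem_filter.mp he
      obtain ⟨ht, hs⟩ := Finset.mem_product.mp he
      have htB : t ∈ B := (hN (k + 1)).1 ht
      have hsB : s ∈ B := (hN k).1 hs
      set σ := D * (2 * r / 2 ^ k) with hσ
      have hσ0 : 0 < σ := by positivity
      have hmom : BernsteinMoments P (fun z => Y t z - Y s z) σ σ :=
        (hY t htB s hsB).mono (by positivity) (by positivity)
          (mul_le_mul_of_nonneg_left hts hD.le) (mul_le_mul_of_nonneg_left hts hD.le)
      -- This l gives lσ = d/2 ≤ 1/2, within the Bernstein range, and the same variance term n d²/4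
      -- at every level.
      have hb := hmom.measure_abs_sum_gt_le ((hYm t htB).sub (hYm s hsB)) hσ0.le n
        (l := d / (2 * σ)) (by positivity) (by field_simp; linarith) (a * ((k + 1) / 2 ^ k))
      have hset : {Z : Fin n → Ω | a * ((k + 1) / 2 ^ k) < |F Z t - F Z s|} =
          {Z | a * ((k + 1) / 2 ^ k) <
            |∑ i, (Y t (Z i) - Y s (Z i) - ∫ z, (Y t z - Y s z) ∂P)|} := by
        ext Z
        have : F Z t - F Z s = ∑ i, (Y t (Z i) - Y s (Z i) - ∫ z, (Y t z - Y s z) ∂P) := by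
          rw [← Finset.sum_sub_distrib]
          refine Finset.sum_congr rfl fun i _ => ?_
          rw [integral_sub (hYi t htB) (hYi s hsB)]
          ring
        rw [Set.mem_ofPred_eq, Set.mem_ofPred_eq, this]
      change Q {Z | a * ((k + 1) / 2 ^ k) < |F Z t - F Z s|} ≤ _
      rw [hset, ← ENNReal.ofReal_toReal (measure_ne_top Q _)]
      refine ENNReal.ofReal_le_ofReal (hb.trans ?_)
      gcongr
      have h1 : d / (2 * σ) * (a * ((k + 1) / 2 ^ k)) = T / 2 * (k + 1) * (n * d ^ 2) := by
        simp only [a, hσ]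
        field_simp
      have h2 : (n : ℝ) * ((d / (2 * σ)) ^ 2 * σ ^ 2) = 1 / 4 * (n * d ^ 2) := by
        field_simp
        norm_num
      rw [h1, h2]
      have h3 : 0 ≤ (k : ℝ) * (n * d ^ 2) := by positivity
      nlinarith
    have hcard : (((N (k + 1) ×ˢ N k).filter fun e => ‖e.1 - e.2‖ ≤ 2 * r / 2 ^ k).card : ℝ) ≤
        Real.exp (4 * (k + 1) * (C * n * d ^ 2)) := by
      have h1 : ((N (k + 1) ×ˢ N k).filter fun e => ‖e.1 - e.2‖ ≤ 2 * r / 2 ^ k).card ≤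
          5 ^ ((2 * k + 1) * Module.finrank ℝ E) := by
        refine (Finset.card_filter_le _ _).trans ?_
        rw [Finset.card_product]
        refine (Nat.mul_le_mul (hN (k + 1)).2.1 (hN k).2.1).trans (le_of_eq ?_)
        rw [← pow_add]
        congr 1
        ring
      have h2 : (((N (k + 1) ×ˢ N k).filter fun e => ‖e.1 - e.2‖ ≤ 2 * r / 2 ^ k).card : ℝ) ≤
          5 ^ ((2 * k + 1) * Module.finrank ℝ E) := mod_cast h1
      refine h2.trans ((five_pow_le_exp _).trans (Real.exp_le_exp.mpr ?_))
      push_cast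
      have h3 : (0 : ℝ) ≤ k := by positivity
      have h4 : (0 : ℝ) ≤ Module.finrank ℝ E := by positivity
      calc 2 * ((2 * (k : ℝ) + 1) * Module.finrank ℝ E)
          ≤ 4 * (k + 1) * Module.finrank ℝ E := by nlinarith
        _ ≤ _ := mul_le_mul_of_nonneg_left hp (by positivity)
    refine (measure_biUnion_finset_le _ _).trans ((Finset.sum_le_sum hedge).trans ?_)
    rw [Finset.sum_const, nsmul_eq_mul, ← ENNReal.ofReal_natCast,
      ← ENNReal.ofReal_mul (by positivity)]
    refine ENNReal.ofReal_le_ofReal ?_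
    refine (mul_le_mul_of_nonneg_right hcard (by positivity)).trans (le_of_eq ?_)
    rw [mul_left_comm, ← Real.exp_add, mul_assoc 2 ρ, ← pow_succ', hρ, ← Real.exp_nat_mul]
    congr 2
    rw [hT]
    push_cast
    ring
  -- After the union over pairs, level k costs 2ρ^(k+1); as ρ ≤ 1/2, all levels together cost at
  -- most 4ρ.
  have hgeo : HasSum (fun k : ℕ => 2 * ρ * ρ ^ k) (2 * ρ * (1 - ρ)⁻¹) :=
    (hasSum_geometric_of_lt_one hρ0.le (by linarith)).mul_left _
  refine (measure_mono hsub).trans ((measure_iUnion_le bad).trans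
    ((ENNReal.tsum_le_tsum hbad).trans ?_))
  rw [← ENNReal.ofReal_tsum_of_nonneg (fun k => by positivity) hgeo.summable, hgeo.tsum_eq]
  refine ENNReal.ofReal_le_ofReal ?_
  have h1 : (1 - ρ)⁻¹ ≤ 2 := by
    rw [inv_le_comm₀ (by linarith) (by norm_num)]
    linarith
  nlinarith

/-! ### Symmetric matrices and quadratic forms -/

section QuadForm

variable {p : ℕ}

theorem inner_toEuclideanCLM (A : Matrix (Fin p) (Fin p) ℝ) (u v : EuclideanSpace ℝ (Fin p)) :
    inner ℝ u (Matrix.toEuclideanCLM (𝕜 := ℝ) A v) = dotProduct u.ofLp (A.mulVec v.ofLp) := by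
  rw [EuclideanSpace.inner_eq_star_dotProduct, Matrix.ofLp_toEuclideanCLM, dotProduct_comm]
  simp

theorem quadForm_eq_inner (A : Matrix (Fin p) (Fin p) ℝ) (v : EuclideanSpace ℝ (Fin p)) :
    quadForm A v = inner ℝ v (Matrix.toEuclideanCLM (𝕜 := ℝ) A v) :=
  (inner_toEuclideanCLM A v v).symm

theorem inner_toEuclideanCLM_comm {A : Matrix (Fin p) (Fin p) ℝ} (hA : A.IsSymm)
    (u v : EuclideanSpace ℝ (Fin p)) :
    inner ℝ u (Matrix.toEuclideanCLM (𝕜 := ℝ) A v) =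
      inner ℝ v (Matrix.toEuclideanCLM (𝕜 := ℝ) A u) := by
  rw [inner_toEuclideanCLM, inner_toEuclideanCLM, Matrix.dotProduct_mulVec,
    ← Matrix.mulVec_transpose, hA.eq, dotProduct_comm]

theorem quadForm_smul (A : Matrix (Fin p) (Fin p) ℝ) (c : ℝ) (v : EuclideanSpace ℝ (Fin p)) :
    quadForm A (c • v) = c ^ 2 * quadForm A v := by
  rw [quadForm_eq_inner, quadForm_eq_inner, map_smul, real_inner_smul_left, real_inner_smul_right]
  ring

theorem quadForm_add (A A' : Matrix (Fin p) (Fin p) ℝ) (v : EuclideanSpace ℝ (Fin p)) :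
    quadForm (A + A') v = quadForm A v + quadForm A' v := by
  simp [quadForm, Matrix.add_mulVec, dotProduct_add]

theorem quadForm_neg (A : Matrix (Fin p) (Fin p) ℝ) (v : EuclideanSpace ℝ (Fin p)) :
    quadForm (-A) v = -quadForm A v := by
  simp [quadForm, Matrix.neg_mulVec, dotProduct_neg]

theorem quadForm_sub (A A' : Matrix (Fin p) (Fin p) ℝ) (v : EuclideanSpace ℝ (Fin p)) :
    quadForm (A - A') v = quadForm A v - quadForm A' v := by
  rw [sub_eq_add_neg, quadForm_add, quadForm_neg, sub_eq_add_neg]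

theorem quadForm_eq_sum (A : Matrix (Fin p) (Fin p) ℝ) (v : EuclideanSpace ℝ (Fin p)) :
    quadForm A v = ∑ i, ∑ j, v i * v j * A i j := by
  simp only [quadForm, dotProduct, Matrix.mulVec, Finset.mul_sum]
  refine Finset.sum_congr rfl fun i _ => Finset.sum_congr rfl fun j _ => ?_
  ring

theorem abs_quadForm_le_matrixOpNorm (A : Matrix (Fin p) (Fin p) ℝ)
    (v : EuclideanSpace ℝ (Fin p)) : |quadForm A v| ≤ matrixOpNorm A * ‖v‖ ^ 2 := by
  rw [quadForm_eq_inner]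
  refine (abs_real_inner_le_norm _ _).trans ?_
  have := (Matrix.toEuclideanCLM (𝕜 := ℝ) A).le_opNorm v
  unfold matrixOpNorm
  nlinarith [norm_nonneg v]

/-- By symmetry, polarization writes the bilinear form as a difference of quadratic forms, and the
parallelogram law bounds it. -/
theorem matrixOpNorm_le_of_abs_quadForm_le {A : Matrix (Fin p) (Fin p) ℝ} (hA : A.IsSymm) {m : ℝ}
    (hm : 0 ≤ m) (h : ∀ v : EuclideanSpace ℝ (Fin p), ‖v‖ ≤ 1 → |quadForm A v| ≤ m) :
    matrixOpNorm A ≤ m := by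
  have hq : ∀ v : EuclideanSpace ℝ (Fin p), |quadForm A v| ≤ m * ‖v‖ ^ 2 := by
    intro v
    rcases eq_or_ne v 0 with rfl | hv
    · simp [quadForm]
    · have hv' := norm_pos_iff.mpr hv
      have h1 := h (‖v‖⁻¹ • v) (by rw [norm_smul, norm_inv, norm_norm, inv_mul_cancel₀ hv'.ne'])
      rw [quadForm_smul, abs_mul, abs_of_nonneg (sq_nonneg _), inv_pow,
        inv_mul_le_iff₀ (by positivity)] at h1
      linarith
  have hB : ∀ x y : EuclideanSpace ℝ (Fin p),
      4 * |inner ℝ x (Matrix.toEuclideanCLM (𝕜 := ℝ) A y)| ≤ 2 * m * (‖x‖ ^ 2 + ‖y‖ ^ 2) := by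
    intro x y
    have h1 : 4 * inner ℝ x (Matrix.toEuclideanCLM (𝕜 := ℝ) A y) =
        quadForm A (x + y) - quadForm A (x - y) := by
      rw [quadForm_eq_inner, quadForm_eq_inner, map_add, map_sub]
      simp only [inner_add_left, inner_add_right, inner_sub_left, inner_sub_right]
      rw [inner_toEuclideanCLM_comm hA y x]
      ring
    have h2 : 4 * |inner ℝ x (Matrix.toEuclideanCLM (𝕜 := ℝ) A y)| =
        |4 * inner ℝ x (Matrix.toEuclideanCLM (𝕜 := ℝ) A y)| := by
      rw [abs_mul, abs_of_pos (by norm_num : (0 : ℝ) < 4)]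
    rw [h2, h1]
    refine (abs_sub _ _).trans ((add_le_add (hq _) (hq _)).trans (le_of_eq ?_))
    have := parallelogram_law_with_norm ℝ x y
    rw [← mul_add]
    linear_combination m * this
  refine ContinuousLinearMap.opNorm_le_bound _ hm fun v => ?_
  rcases eq_or_ne (Matrix.toEuclideanCLM (𝕜 := ℝ) A v) 0 with h0 | h0
  · rw [h0, norm_zero]
    positivity
  rcases eq_or_ne v 0 with rfl | hv
  · simp
  set w := Matrix.toEuclideanCLM (𝕜 := ℝ) A v with hw
  have hw' := norm_pos_iff.mpr h0
  have hv' := norm_pos_iff.mpr hv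
  -- Giving w the length of v makes the bound on the sum of squares sharp, so no constant is lost.
  have h1 := hB ((‖v‖ * ‖w‖⁻¹) • w) v
  rw [← hw, real_inner_smul_left, real_inner_self_eq_norm_sq, norm_smul, norm_mul, norm_inv,
    norm_norm, norm_norm, inv_mul_cancel_right₀ hw'.ne', abs_of_nonneg (by positivity)] at h1
  have h2 : ‖v‖ * ‖w‖⁻¹ * ‖w‖ ^ 2 = ‖v‖ * ‖w‖ := by field_simp
  rw [h2] at h1
  have h3 : ‖v‖ * ‖w‖ ≤ ‖v‖ * (m * ‖v‖) := by nlinarith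
  exact le_of_mul_le_mul_left h3 hv'

/-- Moving from u to a net point v changes the form by ⟨u - v, A(u + v)⟩, at most half the operator
norm, which is absorbed on the left. -/
theorem matrixOpNorm_le_of_net {A : Matrix (Fin p) (Fin p) ℝ} (hA : A.IsSymm) {m : ℝ}
    (hm : 0 ≤ m) {V : Finset (EuclideanSpace ℝ (Fin p))}
    (hV1 : ∀ v ∈ V, ‖v‖ ≤ 1)
    (hV : ∀ u : EuclideanSpace ℝ (Fin p), ‖u‖ ≤ 1 → ∃ v ∈ V, ‖u - v‖ ≤ 1 / 4)
    (h : ∀ v ∈ V, |quadForm A v| ≤ m) : matrixOpNorm A ≤ 2 * m := by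
  have h0 : 0 ≤ matrixOpNorm A := norm_nonneg _
  suffices matrixOpNorm A ≤ m + matrixOpNorm A / 2 by linarith
  refine matrixOpNorm_le_of_abs_quadForm_le hA (by positivity) fun u hu => ?_
  obtain ⟨v, hv, huv⟩ := hV u hu
  have h1 : quadForm A u = quadForm A v +
      inner ℝ (u - v) (Matrix.toEuclideanCLM (𝕜 := ℝ) A (u + v)) := by
    rw [quadForm_eq_inner, quadForm_eq_inner, map_add]
    simp only [inner_add_right, inner_sub_left]
    rw [inner_toEuclideanCLM_comm hA v u]
    ring
  rw [h1]
  refine (abs_add_le _ _).trans (add_le_add (h v hv) ?_)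
  refine (abs_real_inner_le_norm _ _).trans ?_
  have h2 : ‖Matrix.toEuclideanCLM (𝕜 := ℝ) A (u + v)‖ ≤ matrixOpNorm A * 2 := by
    refine ((Matrix.toEuclideanCLM (𝕜 := ℝ) A).le_opNorm _).trans
      (mul_le_mul_of_nonneg_left ?_ h0)
    have := norm_add_le u v
    have := hV1 v hv
    linarith
  calc ‖u - v‖ * ‖Matrix.toEuclideanCLM (𝕜 := ℝ) A (u + v)‖
      ≤ 1 / 4 * (matrixOpNorm A * 2) := by gcongr
    _ = matrixOpNorm A / 2 := by ring

/-- Subtracting the smallest eigenvalue times the identity leaves a positive semidefinite matrix. -/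
theorem lambdaMin_le_quadForm {A : Matrix (Fin p) (Fin p) ℝ} (hA : A.IsSymm)
    {u : EuclideanSpace ℝ (Fin p)} (hu : ‖u‖ = 1) : lambdaMin A ≤ quadForm A u := by
  have hH : A.IsHermitian := by
    rw [Matrix.IsHermitian, Matrix.conjTranspose_eq_transpose_of_trivial]
    exact hA
  have hH' : (A - lambdaMin A • (1 : Matrix (Fin p) (Fin p) ℝ)).IsHermitian :=
    hH.sub (Matrix.IsHermitian.smul Matrix.isHermitian_one (IsSelfAdjoint.all _))
  have hpsd : (A - lambdaMin A • (1 : Matrix (Fin p) (Fin p) ℝ)).PosSemidef := by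
    rw [hH'.posSemidef_iff_eigenvalues_nonneg]
    intro i
    change (0 : ℝ) ≤ hH'.eigenvalues i
    have h1 : hH'.eigenvalues i ∈
        spectrum ℝ (A - lambdaMin A • (1 : Matrix (Fin p) (Fin p) ℝ)) := by
      rw [hH'.spectrum_real_eq_range_eigenvalues]
      exact ⟨i, rfl⟩
    generalize hH'.eigenvalues i = e at h1 ⊢
    rw [← Algebra.algebraMap_eq_smul_one, ← spectrum.sub_singleton_eq] at h1
    obtain ⟨a, ha, b, hb, hab⟩ := Set.mem_sub.mp h1
    rw [Set.mem_singleton_iff] at hb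
    have h2 : lambdaMin A ≤ a := by
      refine csInf_le ?_ ha
      rw [hH.spectrum_real_eq_range_eigenvalues]
      exact (Set.finite_range _).bddBelow
    rw [← hab, hb]
    linarith
  have h := hpsd.dotProduct_mulVec_nonneg u.ofLp
  have h3 : dotProduct (star u.ofLp)
      ((A - lambdaMin A • (1 : Matrix (Fin p) (Fin p) ℝ)).mulVec u.ofLp) =
      quadForm A u - lambdaMin A * ‖u‖ ^ 2 := by
    rw [star_trivial, Matrix.sub_mulVec, dotProduct_sub, Matrix.smul_mulVec, Matrix.one_mulVec,
      dotProduct_smul, EuclideanSpace.real_norm_sq_eq]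
    simp [quadForm, dotProduct, sq]
  rw [h3, hu] at h
  linarith

/-- Each eigenvalue is the form at a unit eigenvector. For p = 0 the spectrum is empty and `sInf`
would be 0. -/
theorem le_lambdaMin_of_le_quadForm (hp : 1 ≤ p) {A : Matrix (Fin p) (Fin p) ℝ} (hA : A.IsSymm)
    {c : ℝ} (h : ∀ u : EuclideanSpace ℝ (Fin p), ‖u‖ = 1 → c ≤ quadForm A u) :
    c ≤ lambdaMin A := by
  have hH : A.IsHermitian := by
    rw [Matrix.IsHermitian, Matrix.conjTranspose_eq_transpose_of_trivial]
    exact hA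
  have : Nonempty (Fin p) := ⟨⟨0, hp⟩⟩
  unfold lambdaMin
  rw [hH.spectrum_real_eq_range_eigenvalues]
  refine le_csInf (Set.range_nonempty _) ?_
  rintro _ ⟨i, rfl⟩
  have hu := hH.eigenvectorBasis.orthonormal.1 i
  have h1 := h _ hu
  have h2 : quadForm A (hH.eigenvectorBasis i) = hH.eigenvalues i := by
    unfold quadForm
    rw [hH.mulVec_eigenvectorBasis, dotProduct_smul]
    have h3 := EuclideanSpace.real_norm_sq_eq (hH.eigenvectorBasis i)
    rw [hu] at h3
    simp only [dotProduct, smul_eq_mul, ← sq, ← h3]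
    norm_num
  rwa [h2] at h1

end QuadForm

/-! ### Gradients and Hessians within a closed ball -/

section Calculus

variable {p : ℕ} {x : EuclideanSpace ℝ (Fin p)} {r : ℝ}

theorem uniqueDiffOn_closedBall_of_pos {E : Type*} [NormedAddCommGroup E] [NormedSpace ℝ E]
    (x : E) {r : ℝ} (hr : 0 < r) : UniqueDiffOn ℝ (Metric.closedBall x r) := by
  refine uniqueDiffOn_convex (convex_closedBall x r) ?_
  rw [interior_closedBall x hr.ne']
  exact ⟨x, Metric.mem_ball_self hr⟩

theorem inner_gradientWithin {E : Type*} [NormedAddCommGroup E] [InnerProductSpace ℝ E]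
    [CompleteSpace E] (f : E → ℝ) (s : Set E) (x v : E) :
    inner ℝ v (gradientWithin f s x) = fderivWithin ℝ f s x v := by
  rw [real_inner_comm, gradientWithin, InnerProductSpace.toDual_symm_apply]

variable {f : EuclideanSpace ℝ (Fin p) → ℝ}

theorem hessianWithin_isSymm (hr : 0 < r) (hf : ContDiffOn ℝ 2 f (Metric.closedBall x r))
    {y : EuclideanSpace ℝ (Fin p)} (hy : y ∈ Metric.closedBall x r) :
    (hessianWithin f (Metric.closedBall x r) y).IsSymm := by
  have hcl : y ∈ closure (interior (Metric.closedBall x r)) := by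
    rwa [interior_closedBall x hr.ne', closure_ball x hr.ne']
  have h := (hf y hy).isSymmSndFDerivWithinAt (by simp)
    (uniqueDiffOn_closedBall_of_pos x hr) hcl hy
  refine Matrix.IsSymm.ext fun i j => ?_
  exact h.eq _ _

theorem continuousOn_hessianWithin_apply (hr : 0 < r)
    (hf : ContDiffOn ℝ 2 f (Metric.closedBall x r)) (i j : Fin p) :
    ContinuousOn (fun y => hessianWithin f (Metric.closedBall x r) y i j)
      (Metric.closedBall x r) := by
  have hB := uniqueDiffOn_closedBall_of_pos x hr
  have h1 : ContDiffOn ℝ 1 (fderivWithin ℝ f (Metric.closedBall x r)) (Metric.closedBall x r) :=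
    hf.fderivWithin hB (by norm_num)
  have h2 := h1.continuousOn_fderivWithin hB le_rfl
  exact (h2.clm_apply continuousOn_const).clm_apply continuousOn_const

theorem continuousOn_quadForm_hessianWithin (hr : 0 < r)
    (hf : ContDiffOn ℝ 2 f (Metric.closedBall x r)) (v : EuclideanSpace ℝ (Fin p)) :
    ContinuousOn (fun y => quadForm (hessianWithin f (Metric.closedBall x r) y) v)
      (Metric.closedBall x r) := by
  simp_rw [quadForm_eq_sum]
  exact continuousOn_finsetSum _ fun i _ => continuousOn_finsetSum _ fun j _ =>
    continuousOn_const.mul (continuousOn_hessianWithin_apply hr hf i j)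

variable {ι : Type*} [Fintype ι] {g : ι → EuclideanSpace ℝ (Fin p) → ℝ}

theorem fderivWithin_sum_of_contDiffOn (hr : 0 < r)
    (hg : ∀ i, ContDiffOn ℝ 2 (g i) (Metric.closedBall x r)) {y : EuclideanSpace ℝ (Fin p)}
    (hy : y ∈ Metric.closedBall x r) :
    fderivWithin ℝ (fun y => ∑ i, g i y) (Metric.closedBall x r) y =
      ∑ i, fderivWithin ℝ (g i) (Metric.closedBall x r) y :=
  fderivWithin_fun_sum (uniqueDiffOn_closedBall_of_pos x hr y hy) fun i _ =>
    (hg i).differentiableOn (by norm_num) y hy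

theorem gradientWithin_sum_of_contDiffOn (hr : 0 < r)
    (hg : ∀ i, ContDiffOn ℝ 2 (g i) (Metric.closedBall x r)) {y : EuclideanSpace ℝ (Fin p)}
    (hy : y ∈ Metric.closedBall x r) :
    gradientWithin (fun y => ∑ i, g i y) (Metric.closedBall x r) y =
      ∑ i, gradientWithin (g i) (Metric.closedBall x r) y := by
  simp only [gradientWithin]
  rw [fderivWithin_sum_of_contDiffOn hr hg hy, map_sum]

theorem hessianWithin_sum_of_contDiffOn (hr : 0 < r)
    (hg : ∀ i, ContDiffOn ℝ 2 (g i) (Metric.closedBall x r)) {y : EuclideanSpace ℝ (Fin p)}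
    (hy : y ∈ Metric.closedBall x r) :
    hessianWithin (fun y => ∑ i, g i y) (Metric.closedBall x r) y =
      ∑ i, hessianWithin (g i) (Metric.closedBall x r) y := by
  have hB := uniqueDiffOn_closedBall_of_pos x hr
  ext i j
  rw [Matrix.sum_apply]
  simp only [hessianWithin, Matrix.of_apply]
  rw [fderivWithin_congr (fun y hy => fderivWithin_sum_of_contDiffOn hr hg hy)
    (fderivWithin_sum_of_contDiffOn hr hg hy), fderivWithin_fun_sum (hB y hy)]
  · simp
  · intro k _
    exact ((hg k).fderivWithin hB (m := 1) (by norm_num)).differentiableOn (by norm_num) y hy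

end Calculus

/-! ### Measurability of gradients and Hessians in the observation -/

section Measurability

variable {Ω : Type*} [MeasurableSpace Ω] {P : Measure Ω}

/-- At interior points the directional derivative is a sequential limit of difference quotients. -/
theorem aemeasurable_fderivWithin_closedBall {E : Type*} [NormedAddCommGroup E] [NormedSpace ℝ E]
    {x : E} {r : ℝ} {G : Ω → E → ℝ} (hG : ∀ y ∈ Metric.ball x r, AEMeasurable (fun z => G z y) P)
    (hd : ∀ᵐ z ∂P, DifferentiableOn ℝ (G z) (Metric.closedBall x r)) {y : E}
    (hy : y ∈ Metric.ball x r) (v : E) :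
    AEMeasurable (fun z => fderivWithin ℝ (G z) (Metric.closedBall x r) y v) P := by
  have hlim0 : Filter.Tendsto (fun k : ℕ => ((k : ℝ) + 1)⁻¹) Filter.atTop (nhds 0) := by
    simpa [one_div] using tendsto_one_div_add_atTop_nhds_zero_nat (𝕜 := ℝ)
  have hlim1 : Filter.Tendsto (fun k : ℕ => y + ((k : ℝ) + 1)⁻¹ • v) Filter.atTop (nhds y) := by
    simpa using (hlim0.smul_const v).const_add y
  -- Shifting the index by K keeps every sampled point inside the open ball.
  obtain ⟨K, hK⟩ := Filter.eventually_atTop.mp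
    (hlim1.eventually (Metric.isOpen_ball.mem_nhds hy))
  refine aemeasurable_of_tendsto_metrizable_ae Filter.atTop
    (f := fun (k : ℕ) z => (((k + K : ℕ) : ℝ) + 1) *
      (G z (y + (((k + K : ℕ) : ℝ) + 1)⁻¹ • v) - G z y)) (fun k => ?_) ?_
  · exact ((hG _ (hK (k + K) (by omega))).sub (hG y hy)).const_mul _
  · filter_upwards [hd] with z hz
    have hnhds : Metric.closedBall x r ∈ nhds y :=
      Filter.mem_of_superset (Metric.isOpen_ball.mem_nhds hy) Metric.ball_subset_closedBall
    have hdiff : DifferentiableAt ℝ (G z) y :=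
      (hz y (Metric.ball_subset_closedBall hy)).differentiableAt hnhds
    rw [fderivWithin_of_mem_nhds hnhds]
    have hlin := hdiff.hasFDerivAt.lim_real v
    have htop : Filter.Tendsto (fun k : ℕ => ((k + K : ℕ) : ℝ) + 1) Filter.atTop Filter.atTop :=
      Filter.tendsto_atTop_add_const_right _ _
        (tendsto_natCast_atTop_atTop.comp (Filter.tendsto_add_atTop_nat K))
    have := hlin.comp htop
    simpa [Function.comp_def] using this

theorem aemeasurable_of_continuousOn_closedBall {E : Type*} [NormedAddCommGroup E]
    [NormedSpace ℝ E] {x : E} {r : ℝ} {G : Ω → E → ℝ} (hr : 0 < r)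
    (hG : ∀ y ∈ Metric.ball x r, AEMeasurable (fun z => G z y) P)
    (hc : ∀ᵐ z ∂P, ContinuousOn (G z) (Metric.closedBall x r)) {y : E}
    (hy : y ∈ Metric.closedBall x r) : AEMeasurable (fun z => G z y) P := by
  have hcl : y ∈ closure (Metric.ball x r) := by rwa [closure_ball x hr.ne']
  obtain ⟨u, hu, hlim⟩ := mem_closure_iff_seq_limit.mp hcl
  refine aemeasurable_of_tendsto_metrizable_ae Filter.atTop (f := fun k z => G z (u k))
    (fun k => hG _ (hu k)) ?_
  filter_upwards [hc] with z hz
  exact (hz y hy).tendsto.comp (tendsto_nhdsWithin_iff.mpr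
    ⟨hlim, Filter.Eventually.of_forall fun k => Metric.ball_subset_closedBall (hu k)⟩)

variable {p : ℕ} {x : EuclideanSpace ℝ (Fin p)} {r : ℝ} {f : Ω → EuclideanSpace ℝ (Fin p) → ℝ}

theorem aemeasurable_inner_gradientWithin (hr : 0 < r)
    (hf : ∀ y ∈ Metric.ball x r, AEMeasurable (fun z => f z y) P)
    (hC2 : ∀ᵐ z ∂P, ContDiffOn ℝ 2 (f z) (Metric.closedBall x r))
    (v : EuclideanSpace ℝ (Fin p)) :
    AEMeasurable (fun z => inner ℝ v (gradientWithin (f z) (Metric.closedBall x r) x)) P := by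
  simp_rw [inner_gradientWithin]
  exact aemeasurable_fderivWithin_closedBall hf
    (hC2.mono fun z hz => hz.differentiableOn (by norm_num)) (Metric.mem_ball_self hr) v

/-- Inside the ball, an entry is a directional derivative of a directional derivative; boundary
points follow by continuity. -/
theorem aemeasurable_hessianWithin_apply (hr : 0 < r)
    (hf : ∀ y ∈ Metric.ball x r, AEMeasurable (fun z => f z y) P)
    (hC2 : ∀ᵐ z ∂P, ContDiffOn ℝ 2 (f z) (Metric.closedBall x r))
    {y : EuclideanSpace ℝ (Fin p)} (hy : y ∈ Metric.closedBall x r) (i j : Fin p) :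
    AEMeasurable (fun z => hessianWithin (f z) (Metric.closedBall x r) y i j) P := by
  have hB := uniqueDiffOn_closedBall_of_pos x hr
  refine aemeasurable_of_continuousOn_closedBall
    (G := fun z y => hessianWithin (f z) (Metric.closedBall x r) y i j) hr (fun y hy => ?_)
    (hC2.mono fun z hz => continuousOn_hessianWithin_apply hr hz i j) hy
  set ei := EuclideanSpace.single i (1 : ℝ)
  set ej := EuclideanSpace.single j (1 : ℝ)
  have hdd : ∀ᵐ z ∂P, DifferentiableOn ℝ (fderivWithin ℝ (f z) (Metric.closedBall x r))
      (Metric.closedBall x r) := hC2.mono fun z hz =>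
    (hz.fderivWithin hB (m := 1) (by norm_num)).differentiableOn (by norm_num)
  have h1 : ∀ y ∈ Metric.ball x r,
      AEMeasurable (fun z => fderivWithin ℝ (f z) (Metric.closedBall x r) y ej) P := fun y hy =>
    aemeasurable_fderivWithin_closedBall hf
      (hC2.mono fun z hz => hz.differentiableOn (by norm_num)) hy ej
  have h2 := aemeasurable_fderivWithin_closedBall
    (G := fun z y => fderivWithin ℝ (f z) (Metric.closedBall x r) y ej) h1
    (hdd.mono fun z hz => hz.clm_apply (differentiableOn_const _)) hy ei
  refine h2.congr ?_
  filter_upwards [hdd] with z hz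
  have hyB := Metric.ball_subset_closedBall hy
  have h3 := ((hz y hyB).hasFDerivWithinAt.clm_apply
    (hasFDerivWithinAt_const ej y (Metric.closedBall x r))).fderivWithin (hB y hyB)
  rw [h3]
  simp [hessianWithin, ei, ej]

theorem aemeasurable_quadForm_hessianWithin (hr : 0 < r)
    (hf : ∀ y ∈ Metric.ball x r, AEMeasurable (fun z => f z y) P)
    (hC2 : ∀ᵐ z ∂P, ContDiffOn ℝ 2 (f z) (Metric.closedBall x r))
    {y : EuclideanSpace ℝ (Fin p)} (hy : y ∈ Metric.closedBall x r)
    (v : EuclideanSpace ℝ (Fin p)) :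
    AEMeasurable (fun z => quadForm (hessianWithin (f z) (Metric.closedBall x r) y) v) P := by
  simp_rw [quadForm_eq_sum]
  exact Finset.aemeasurable_fun_sum _ fun i _ => Finset.aemeasurable_fun_sum _ fun j _ =>
    (aemeasurable_hessianWithin_apply hr hf hC2 hy i j).const_mul _

end Measurability

/-! ### From the sum of the observations to one observation -/

theorem ae_pi_of_ae {Ω : Type*} [MeasurableSpace Ω] {P : Measure Ω} [IsProbabilityMeasure P]
    {n : ℕ} {q : Ω → Prop} (h : ∀ᵐ z ∂P, q z) :
    ∀ᵐ Z ∂(Measure.pi fun _ : Fin n => P), ∀ i, q (Z i) :=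
  ae_all_iff.mpr fun i => (Measure.quasiMeasurePreserving_eval (fun _ : Fin n => P) i).ae h

/-- If a sum of independent copies of a random vector lies in a subspace almost surely, then so
does the random vector. -/
theorem ae_mem_of_ae_sum_mem {Ω : Type*} [MeasurableSpace Ω] {P : Measure Ω}
    [IsProbabilityMeasure P] {W : Type*} [AddCommGroup W] [Module ℝ W] (V : Submodule ℝ W)
    (f : Ω → W) {n : ℕ} (hn : 1 ≤ n)
    (h : ∀ᵐ Z ∂(Measure.pi fun _ : Fin n => P), ∑ i, f (Z i) ∈ V) : ∀ᵐ z ∂P, f z ∈ V := by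
  obtain ⟨m, rfl⟩ : ∃ m, n = m + 1 := ⟨n - 1, by omega⟩
  -- Fubini for null sets freezes all coordinates but one; no measurability of f is needed.
  have hmp := (measurePreserving_piFinSuccAbove (fun _ : Fin (m + 1) => P) 0).symm
  have h1 := hmp.quasiMeasurePreserving.ae h
  have h2 := (Measure.measurePreserving_swap (μ := Measure.pi fun _ : Fin m => P)
    (ν := P)).quasiMeasurePreserving.ae h1
  have h3 := Measure.ae_ae_of_ae_prod h2
  obtain ⟨Z', hZ'⟩ := h3.exists
  have h4 : ∀ᵐ z ∂P, f z + ∑ i, f (Z' i) ∈ V := by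
    filter_upwards [hZ'] with z hz
    simpa [Fin.sum_univ_succ, MeasurableEquiv.piFinSuccAbove] using hz
  set g := ∑ i, f (Z' i) with hg
  -- On a fresh sample, the sums of f(Z i) + g and of f(Z i) both lie in V; their difference is (m +
  -- 1) g.
  obtain ⟨Z, hZ1, hZ2⟩ := ((ae_pi_of_ae (n := m + 1) h4).and h).exists
  have h5 : ((m : ℝ) + 1) • g ∈ V := by
    have h6 : ∑ i : Fin (m + 1), (f (Z i) + g) ∈ V := V.sum_mem fun i _ => hZ1 i
    rw [Finset.sum_add_distrib, Finset.sum_const, Finset.card_univ, Fintype.card_fin] at h6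
    have h7 := V.sub_mem h6 hZ2
    rw [add_sub_cancel_left, ← Nat.cast_smul_eq_nsmul ℝ] at h7
    exact_mod_cast h7
  have h8 : g ∈ V := (V.smul_mem_iff (by positivity)).mp h5
  filter_upwards [h4] with z hz
  exact (V.add_mem_iff_left h8).mp hz

/-- The functions which are twice continuously differentiable on `B`. -/
def contDiffOnSubmodule {E : Type*} [NormedAddCommGroup E] [NormedSpace ℝ E] (B : Set E) :
    Submodule ℝ (E → ℝ) where
  carrier := {f | ContDiffOn ℝ 2 f B}
  add_mem' hf hg := hf.add hg
  zero_mem' := contDiffOn_const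
  smul_mem' c _ hf := hf.const_smul c

/-! ### Expected matrices -/

section ExpectedMatrix

variable {Ω : Type*} [MeasurableSpace Ω] {P : Measure Ω} {p : ℕ}
  {H : Ω → Matrix (Fin p) (Fin p) ℝ}

/-- Polarization with halved vectors, which stay in the unit ball where the moment bounds apply. -/
theorem apply_eq_quadForm_sub {A : Matrix (Fin p) (Fin p) ℝ} (hA : A.IsSymm) (i j : Fin p) :
    A i j =
      quadForm A ((1 / 2 : ℝ) • (EuclideanSpace.single i 1 + EuclideanSpace.single j 1)) -
      quadForm A ((1 / 2 : ℝ) • (EuclideanSpace.single i 1 - EuclideanSpace.single j 1)) := by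
  have h1 : inner ℝ (EuclideanSpace.single i (1 : ℝ))
      (Matrix.toEuclideanCLM (𝕜 := ℝ) A (EuclideanSpace.single j 1)) = A i j := by
    rw [inner_toEuclideanCLM]
    simp
  rw [quadForm_smul, quadForm_smul, quadForm_eq_inner, quadForm_eq_inner, map_add, map_sub]
  simp only [inner_add_left, inner_add_right, inner_sub_left, inner_sub_right]
  rw [inner_toEuclideanCLM_comm hA (EuclideanSpace.single j 1) (EuclideanSpace.single i 1), h1]
  ring

theorem norm_half_smul_single_le (i j : Fin p) :
    ‖(1 / 2 : ℝ) • (EuclideanSpace.single i (1 : ℝ) + EuclideanSpace.single j 1)‖ ≤ 1 ∧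
      ‖(1 / 2 : ℝ) • (EuclideanSpace.single i (1 : ℝ) - EuclideanSpace.single j 1)‖ ≤ 1 := by
  have h1 := norm_add_le (EuclideanSpace.single i (1 : ℝ)) (EuclideanSpace.single j 1)
  have h2 := norm_sub_le (EuclideanSpace.single i (1 : ℝ)) (EuclideanSpace.single j 1)
  rw [PiLp.norm_single, PiLp.norm_single, norm_one] at h1 h2
  rw [norm_smul, norm_smul, Real.norm_eq_abs, abs_of_pos (by norm_num : (0 : ℝ) < 1 / 2)]
  constructor <;> linarith

theorem integrable_apply_of_integrable_quadForm (hS : ∀ᵐ z ∂P, (H z).IsSymm)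
    (hI : ∀ v : EuclideanSpace ℝ (Fin p), ‖v‖ ≤ 1 → Integrable (fun z => quadForm (H z) v) P)
    (i j : Fin p) : Integrable (fun z => H z i j) P := by
  obtain ⟨h1, h2⟩ := norm_half_smul_single_le i j
  refine ((hI _ h1).sub (hI _ h2)).congr ?_
  filter_upwards [hS] with z hz
  exact (apply_eq_quadForm_sub hz i j).symm

theorem quadForm_integral (hI : ∀ i j, Integrable (fun z => H z i j) P)
    (v : EuclideanSpace ℝ (Fin p)) :
    quadForm (Matrix.of fun i j => ∫ z, H z i j ∂P) v = ∫ z, quadForm (H z) v ∂P := by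
  simp_rw [quadForm_eq_sum]
  rw [integral_finsetSum _ fun i _ =>
    integrable_finsetSum _ fun j _ => (hI i j).const_mul _]
  refine Finset.sum_congr rfl fun i _ => ?_
  rw [integral_finsetSum _ fun j _ => (hI i j).const_mul _]
  refine Finset.sum_congr rfl fun j _ => ?_
  rw [integral_const_mul, Matrix.of_apply]

end ExpectedMatrix

/-! ### A simultaneous deviation event -/

/-- With ε = exp(-5Cnd²), each direction costs 2ε for g, 2ε for Y at the centre and 4ε for chaining.
The net has at most exp(4Cnd²) directions, which leaves 8 exp(-Cnd²). Chaining with L = 5C produces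
the constant 144C + 4. -/
theorem exists_deviation_event {E : Type*} [NormedAddCommGroup E] [NormedSpace ℝ E]
    [FiniteDimensional ℝ E] {Ω : Type*} [MeasurableSpace Ω] {P : Measure Ω}
    [IsProbabilityMeasure P] {V : Finset E} (hVc : V.card ≤ 5 ^ (2 * Module.finrank ℝ E))
    {g : E → Ω → ℝ} {Y : E → E → Ω → ℝ} {x : E} {r D σ₁ b₁ σ₂ b₂ : ℝ} (hr : 0 < r) (hD : 0 < D)
    (hb₁ : 0 ≤ b₁) (hb₂ : 0 ≤ b₂)
    (hgm : ∀ v ∈ V, AEMeasurable (g v) P) (hg : ∀ v ∈ V, BernsteinMoments P (g v) σ₁ b₁)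
    (hYm : ∀ v ∈ V, ∀ y ∈ Metric.closedBall x r, AEMeasurable (Y v y) P)
    (hY : ∀ v ∈ V, ∀ y ∈ Metric.closedBall x r, BernsteinMoments P (Y v y) σ₂ b₂)
    (hYY : ∀ v ∈ V, ∀ y ∈ Metric.closedBall x r, ∀ y' ∈ Metric.closedBall x r,
      BernsteinMoments P (fun z => Y v y z - Y v y' z) (D * ‖y - y'‖) (D * ‖y - y'‖))
    {n : ℕ} {G : (Fin n → Ω) → Prop} (hG : ∀ᵐ Z ∂(Measure.pi fun _ : Fin n => P), G Z)
    (hGc : ∀ Z, G Z → ∀ v ∈ V, ContinuousOn (fun y => ∑ i, Y v y (Z i)) (Metric.closedBall x r))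
    {d C : ℝ} (hd : 0 < d) (hd1 : d ≤ 1) (hC : 0 < C)
    (hp : (Module.finrank ℝ E : ℝ) ≤ C * n * d ^ 2) (hA : 1 ≤ C * n * d ^ 2)
    {l₁ t₁ l₂ t₂ : ℝ} (hl₁ : 0 ≤ l₁) (hl₂ : 0 ≤ l₂) (hlb₁ : l₁ * b₁ ≤ 1 / 2)
    (hlb₂ : l₂ * b₂ ≤ 1 / 2)
    (ht₁ : -(l₁ * t₁) + n * (l₁ ^ 2 * σ₁ ^ 2) ≤ -(5 * C * n * d ^ 2))
    (ht₂ : -(l₂ * t₂) + n * (l₂ ^ 2 * σ₂ ^ 2) ≤ -(5 * C * n * d ^ 2)) :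
    ∃ S : Set (Fin n → Ω), MeasurableSet S ∧
      1 - 8 * Real.exp (-(C * n * d ^ 2)) ≤ (Measure.pi fun _ : Fin n => P).real S ∧
      ∀ Z ∈ S, G Z ∧ ∀ v ∈ V, |∑ i, (g v (Z i) - ∫ z, g v z ∂P)| ≤ t₁ ∧
        ∀ y ∈ Metric.closedBall x r, |∑ i, (Y v y (Z i) - ∫ z, Y v y z ∂P)| ≤
          t₂ + (144 * C + 4) * n * d * D * r := by
  set Q := Measure.pi fun _ : Fin n => P with hQ
  have hx : x ∈ Metric.closedBall x r := Metric.mem_closedBall_self hr.le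
  let bg : E → Set (Fin n → Ω) := fun v => {Z | t₁ < |∑ i, (g v (Z i) - ∫ z, g v z ∂P)|}
  let bh : E → Set (Fin n → Ω) := fun v => {Z | t₂ < |∑ i, (Y v x (Z i) - ∫ z, Y v x z ∂P)|}
  let bc : E → Set (Fin n → Ω) := fun v =>
    {Z | ContinuousOn (fun y => ∑ i, Y v y (Z i)) (Metric.closedBall x r) ∧
      ∃ y ∈ Metric.closedBall x r, 8 * (8 * C + 2 * (5 * C) + 1 / 2) * n * d * D * r <
        |∑ i, (Y v y (Z i) - ∫ z, Y v y z ∂P) - ∑ i, (Y v x (Z i) - ∫ z, Y v x z ∂P)|}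
  set ε := Real.exp (-(5 * C * n * d ^ 2)) with hε
  have hbg : ∀ v ∈ V, Q (bg v) ≤ ENNReal.ofReal (2 * ε) := fun v hv => by
    rw [← ENNReal.ofReal_toReal (measure_ne_top Q _)]
    refine ENNReal.ofReal_le_ofReal
      (((hg v hv).measure_abs_sum_gt_le (hgm v hv) hb₁ n hl₁ hlb₁ t₁).trans ?_)
    exact mul_le_mul_of_nonneg_left (Real.exp_le_exp.mpr ht₁) two_pos.le
  have hbh : ∀ v ∈ V, Q (bh v) ≤ ENNReal.ofReal (2 * ε) := fun v hv => by
    rw [← ENNReal.ofReal_toReal (measure_ne_top Q _)]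
    refine ENNReal.ofReal_le_ofReal
      (((hY v hv x hx).measure_abs_sum_gt_le (hYm v hv x hx) hb₂ n hl₂ hlb₂ t₂).trans ?_)
    exact mul_le_mul_of_nonneg_left (Real.exp_le_exp.mpr ht₂) two_pos.le
  have hbc : ∀ v ∈ V, Q (bc v) ≤ ENNReal.ofReal (4 * ε) := fun v hv =>
    measure_exists_chaining_le hr hD (hYm v hv)
      (fun y hy => (hY v hv y hy).integrable (hYm v hv y hy)) (hYY v hv) n hd hd1 hp
      (by linarith) hC.le (by positivity)
  let bad : Set (Fin n → Ω) := {Z | ¬ G Z} ∪ ⋃ v ∈ V, (bg v ∪ bh v ∪ bc v)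
  have hbad : Q bad ≤ ENNReal.ofReal (8 * Real.exp (-(C * n * d ^ 2))) := by
    have h1 : ∀ v ∈ V, Q (bg v ∪ bh v ∪ bc v) ≤ ENNReal.ofReal (8 * ε) := fun v hv => by
      refine (measure_union_le _ _).trans ((add_le_add ((measure_union_le _ _).trans
        (add_le_add (hbg v hv) (hbh v hv))) (hbc v hv)).trans (le_of_eq ?_))
      rw [← ENNReal.ofReal_add (by positivity) (by positivity),
        ← ENNReal.ofReal_add (by positivity) (by positivity)]
      congr 1
      ring
    have h2 : Q {Z | ¬ G Z} = 0 := ae_iff.mp hG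
    refine (measure_union_le _ _).trans ?_
    rw [h2, zero_add]
    refine (measure_biUnion_finset_le _ _).trans ((Finset.sum_le_sum h1).trans ?_)
    rw [Finset.sum_const, nsmul_eq_mul, ← ENNReal.ofReal_natCast,
      ← ENNReal.ofReal_mul (by positivity)]
    refine ENNReal.ofReal_le_ofReal ?_
    have h3 : (V.card : ℝ) ≤ Real.exp (4 * (C * n * d ^ 2)) := by
      have h4 : (V.card : ℝ) ≤ 5 ^ (2 * Module.finrank ℝ E) := mod_cast hVc
      refine h4.trans ((five_pow_le_exp _).trans (Real.exp_le_exp.mpr ?_))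
      push_cast
      linarith
    refine (mul_le_mul_of_nonneg_right h3 (by positivity)).trans (le_of_eq ?_)
    rw [mul_left_comm, hε, ← Real.exp_add]
    congr 2
    ring
  -- The bad set may fail to be measurable, so its measurable hull is removed.
  refine ⟨(toMeasurable Q bad)ᶜ, (measurableSet_toMeasurable _ _).compl, ?_, ?_⟩
  · rw [probReal_compl_eq_one_sub (measurableSet_toMeasurable _ _)]
    refine sub_le_sub_left ?_ 1
    rw [Measure.real, measure_toMeasurable]
    exact ENNReal.toReal_le_of_le_ofReal (by positivity) hbad
  · intro Z hZ
    have hZ' : Z ∉ bad := fun h => hZ (subset_toMeasurable Q bad h)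
    have hGZ : G Z := by
      by_contra h
      exact hZ' (Or.inl h)
    refine ⟨hGZ, fun v hv => ?_⟩
    have hv' : Z ∉ bg v ∪ bh v ∪ bc v := fun h =>
      hZ' (Or.inr (Set.mem_iUnion₂.mpr ⟨v, hv, h⟩))
    have h1 : |∑ i, (g v (Z i) - ∫ z, g v z ∂P)| ≤ t₁ := by
      by_contra! h
      exact hv' (Or.inl (Or.inl h))
    have h2 : |∑ i, (Y v x (Z i) - ∫ z, Y v x z ∂P)| ≤ t₂ := by
      by_contra! h
      exact hv' (Or.inl (Or.inr h))
    refine ⟨h1, fun y hy => ?_⟩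
    have h3 : |∑ i, (Y v y (Z i) - ∫ z, Y v y z ∂P) - ∑ i, (Y v x (Z i) - ∫ z, Y v x z ∂P)| ≤
        8 * (8 * C + 2 * (5 * C) + 1 / 2) * n * d * D * r := by
      by_contra! h
      exact hv' (Or.inr ⟨hGc Z hGZ v hv, y, hy, h⟩)
    have h4 := abs_sub_abs_le_abs_sub (∑ i, (Y v y (Z i) - ∫ z, Y v y z ∂P))
      (∑ i, (Y v x (Z i) - ∫ z, Y v x z ∂P))
    linarith

theorem norm_le_of_net {E : Type*} [NormedAddCommGroup E] [InnerProductSpace ℝ E] {V : Finset E}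
    (hV : ∀ u : E, ‖u‖ ≤ 1 → ∃ v ∈ V, ‖u - v‖ ≤ 1 / 4) {a : E} {m : ℝ}
    (h : ∀ v ∈ V, |inner ℝ v a| ≤ m) : ‖a‖ ≤ 2 * m := by
  obtain ⟨v, hv, huv⟩ := hV (‖a‖⁻¹ • a) (by
    rw [norm_smul, norm_inv, norm_norm]
    exact inv_mul_le_one)
  have h1 : inner ℝ (‖a‖⁻¹ • a) a = ‖a‖ := by
    rw [real_inner_smul_left, real_inner_self_eq_norm_sq]
    rcases eq_or_ne ‖a‖ 0 with h0 | h0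
    · simp [h0]
    · field_simp
  have h2 : ‖a‖ = inner ℝ v a + inner ℝ (‖a‖⁻¹ • a - v) a := by
    rw [inner_sub_left, h1]
    ring
  have h3 := real_inner_le_norm (‖a‖⁻¹ • a - v) a
  have h4 := (le_abs_self _).trans (h v hv)
  have h5 : ‖‖a‖⁻¹ • a - v‖ * ‖a‖ ≤ 1 / 4 * ‖a‖ := by gcongr
  have h6 := norm_nonneg a
  linarith

/-! ### Local bounds for the log-likelihood -/

theorem bernsteinMoments_of_rpow {Ω : Type*} [MeasurableSpace Ω] {P : Measure Ω} {X : Ω → ℝ}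
    {c a b t : ℝ} (ht : 0 < t)
    (h : ∀ q : ℕ, 2 ≤ q → ∫⁻ z, ENNReal.ofReal (|X z| ^ q) ∂P ≤
      ENNReal.ofReal ((q.factorial / 2 : ℝ) * c ^ q * t ^ (2 * a + ((q : ℝ) - 2) * b))) :
    BernsteinMoments P X (c * t ^ a) (c * t ^ b) := fun q => by
  refine (h (q + 2) (by omega)).trans (le_of_eq ?_)
  congr 1
  have h1 : t ^ (2 * a + (((q + 2 : ℕ) : ℝ) - 2) * b) = (t ^ a) ^ 2 * (t ^ b) ^ q := by
    rw [Real.rpow_add ht, mul_comm 2 a, Real.rpow_mul ht.le, Real.rpow_two]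
    congr 1
    push_cast
    rw [add_sub_cancel_right, mul_comm, Real.rpow_mul ht.le, Real.rpow_natCast]
  rw [h1, mul_pow, mul_pow, pow_add]
  ring

namespace DominatedModel

variable {𝒵 : Type*} [MeasurableSpace 𝒵] (M : DominatedModel 𝒵)

theorem isProbabilityMeasure_law {θ : EllTwo} (hθ : θ ∈ M.Θ) :
    IsProbabilityMeasure (M.law θ) := by
  refine ⟨?_⟩
  rw [law, withDensity_apply _ MeasurableSet.univ, Measure.restrict_univ]
  exact M.lintegral_pdf θ hθ

theorem measurable_logLik {p : ℕ} {θ : EuclideanSpace ℝ (Fin p)} (hθ : embedRp p θ ∈ M.Θ) :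
    Measurable fun z => M.logLik p z θ :=
  Real.measurable_log.comp (M.pdf_measurable _ hθ)

theorem ae_contDiffOn_logLik {n p : ℕ} (hn : 1 ≤ n) {θ₀ : EllTwo} (hθ₀ : θ₀ ∈ M.Θ)
    {B : Set (EuclideanSpace ℝ (Fin p))} (h : ∀ᵐ Z ∂(M.lawN n θ₀), M.LogLikC2On p Z B) :
    ∀ᵐ z ∂(M.law θ₀), ContDiffOn ℝ 2 (M.logLik p z) B := by
  have := M.isProbabilityMeasure_law hθ₀
  refine ae_mem_of_ae_sum_mem (contDiffOnSubmodule B) (fun z => M.logLik p z) hn ?_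
  refine h.mono fun Z hZ => ?_
  have h1 : ∑ i, M.logLik p (Z i) = M.logLikN p Z := by
    funext θ
    simp [logLikN]
  rw [h1]
  exact hZ.2

theorem localBoundAndCurvature_of_le_log {κ₁ κ₂ κ₃ κ₄ C C₁ C₂ : ℝ}
    (hκ₁ : 0 ≤ κ₁) (hκ₂ : 0 ≤ κ₂) (hκ₃ : 0 ≤ κ₃)
    (hC : 0 < C) (hC₂ : 0 < C₂) (hC₁₂ : C₂ ≤ C₁) {n p : ℕ} (hn : 1 ≤ n) (hp : 1 ≤ p)
    (hemb : ∀ θ : EuclideanSpace ℝ (Fin p), embedRp p θ ∈ M.Θ) {θ₀ : EllTwo} (hθ₀ : θ₀ ∈ M.Θ)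
    {θs : EuclideanSpace ℝ (Fin p)} {η d : ℝ} (hη : 0 < η)
    (hae : ∀ᵐ Z ∂(M.lawN n θ₀), M.LogLikC2On p Z (Metric.closedBall θs η))
    (hgrowth : GrowthConditions n p η d κ₂ κ₃ κ₄ C)
    (hmean : M.LocalMeanBoundedness p θ₀ θs η d κ₁ κ₂ κ₄ C₁)
    (hcurv : M.LocalMeanCurvature p θ₀ θs η κ₃ C₂)
    (hd : 0 < d) (hd1 : d ≤ 1) (hlog₁ : 2 ≤ C * Real.log n)
    (hlog₂ : 4 * ((154 * C + 5) * C₁) ≤ C * C₂ * Real.log n) :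
    M.LocalBoundAndCurvature n p θ₀ θs η d κ₁ κ₂ κ₃ (C₂ / 2) ((10 * C + 4) * C₁) C 8 := by
  have hprob := M.isProbabilityMeasure_law hθ₀
  have hC₁ : 0 < C₁ := hC₂.trans_le hC₁₂
  obtain ⟨hpn, hgr⟩ := hgrowth
  have hn0 : (0 : ℝ) < n := by exact_mod_cast hn
  have hp1 : (1 : ℝ) ≤ p := by exact_mod_cast hp
  have hp0 : (0 : ℝ) < p := by linarith
  set B := Metric.closedBall θs η with hB
  have hsB : θs ∈ B := Metric.mem_closedBall_self hη.le
  set P := M.law θ₀ with hP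
  set a₁ := (p : ℝ) ^ κ₁ with ha₁
  set a₂ := (p : ℝ) ^ κ₂ with ha₂
  set a₃ := (p : ℝ) ^ (-κ₃) with ha₃
  set a₄ := (p : ℝ) ^ κ₄ with ha₄
  have h1a₁ : 1 ≤ a₁ := Real.one_le_rpow hp1 hκ₁
  have h1a₂ : 1 ≤ a₂ := Real.one_le_rpow hp1 hκ₂
  have ha₃0 : 0 < a₃ := Real.rpow_pos_of_pos hp0 _
  have ha₃1 : a₃ ≤ 1 := Real.rpow_le_one_of_one_le_of_nonpos hp1 (by linarith)
  have ha₄0 : 0 < a₄ := Real.rpow_pos_of_pos hp0 _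
  set w := max (d * a₂) (max (η * d * a₄) (d ^ 2 * a₄)) with hw
  have hw₁ : d * a₂ ≤ w := le_max_left _ _
  have hw₂ : η * d * a₄ ≤ w := (le_max_left _ _).trans (le_max_right _ _)
  have hw₃ : d ^ 2 * a₄ ≤ w := (le_max_right _ _).trans (le_max_right _ _)
  have hw0 : 0 < w := lt_of_lt_of_le (by positivity) hw₁
  have hw_half : w ≤ 1 / 2 := by nlinarith
  -- The logarithm beats the constants here. The sum 154C + 5 covers 10C + 1/2 from the centre and
  -- 144C + 4 from chaining; the 4 is 2 for the net times 2 to keep half the curvature.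
  have hw_curv : 4 * ((154 * C + 5) * C₁) * w ≤ C₂ * a₃ := by
    calc 4 * ((154 * C + 5) * C₁) * w ≤ C * C₂ * Real.log n * w :=
          mul_le_mul_of_nonneg_right hlog₂ hw0.le
      _ = C₂ * (C * w * Real.log n) := by ring
      _ ≤ C₂ * a₃ := mul_le_mul_of_nonneg_left hgr hC₂.le
  have hC2 : ∀ᵐ z ∂P, ContDiffOn ℝ 2 (M.logLik p z) B := M.ae_contDiffOn_logLik hn hθ₀ hae
  have hfm : ∀ y ∈ Metric.ball θs η, AEMeasurable (fun z => M.logLik p z y) P := fun y _ =>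
    (M.measurable_logLik (hemb y)).aemeasurable
  let H : EuclideanSpace ℝ (Fin p) → 𝒵 → Matrix (Fin p) (Fin p) ℝ := fun y z =>
    hessianWithin (M.logLik p z) B y
  let g : EuclideanSpace ℝ (Fin p) → 𝒵 → ℝ := fun v z =>
    inner ℝ v (gradientWithin (M.logLik p z) B θs)
  let Y : EuclideanSpace ℝ (Fin p) → EuclideanSpace ℝ (Fin p) → 𝒵 → ℝ := fun v y z =>
    quadForm (H y z) v
  have hgm : ∀ v, AEMeasurable (g v) P := aemeasurable_inner_gradientWithin hη hfm hC2
  have hYm : ∀ v, ∀ y ∈ B, AEMeasurable (Y v y) P := fun v y hy =>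
    aemeasurable_quadForm_hessianWithin hη hfm hC2 hy v
  have hgB : ∀ v, ‖v‖ ≤ 1 → BernsteinMoments P (g v) (C₁ * a₁) (C₁ * a₂) := fun v hv =>
    bernsteinMoments_of_rpow hp0 fun q hq => ((hmean v hv).2 q hq).1
  have hYB : ∀ v, ‖v‖ ≤ 1 → ∀ y ∈ B, BernsteinMoments P (Y v y) (C₁ * a₂) (C₁ * a₄) :=
    fun v hv y hy => bernsteinMoments_of_rpow hp0 fun q hq => ((hmean v hv).2 q hq).2.1 y hy
  have hYYB : ∀ v, ‖v‖ ≤ 1 → ∀ y ∈ B, ∀ y' ∈ B,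
      BernsteinMoments P (fun z => Y v y z - Y v y' z) (C₁ * a₄ * ‖y - y'‖)
        (C₁ * a₄ * ‖y - y'‖) := fun v hv y hy y' hy' q => by
    have h := ((hmean v hv).2 (q + 2) (by omega)).2.2 y hy y' hy'
    simp_rw [quadForm_sub] at h
    refine h.trans (le_of_eq ?_)
    rw [← pow_add, add_comm 2 q]
  have hEg : ∀ v, ‖v‖ ≤ 1 → |∫ z, g v z ∂P| ≤ C₁ * d * a₁ := fun v hv => (hmean v hv).1
  have hEY : ∀ v, ‖v‖ ≤ 1 → ∀ y ∈ B, |∫ z, Y v y z ∂P| ≤ C₁ * a₂ := fun v hv y hy =>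
    (hYB v hv y hy).abs_integral_le (hYm v y hy) (by positivity)
  -- expected Hessians
  have hHs : ∀ y ∈ B, ∀ᵐ z ∂P, (H y z).IsSymm := fun y hy =>
    hC2.mono fun z hz => hessianWithin_isSymm hη hz hy
  have hHi : ∀ y ∈ B, ∀ i j, Integrable (fun z => H y z i j) P := fun y hy =>
    integrable_apply_of_integrable_quadForm (hHs y hy) fun v hv =>
      (hYB v hv y hy).integrable (hYm v y hy)
  let EH : EuclideanSpace ℝ (Fin p) → Matrix (Fin p) (Fin p) ℝ := fun y =>
    Matrix.of fun i j => ∫ z, H y z i j ∂P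
  have hEHs : ∀ y ∈ B, (EH y).IsSymm := fun y hy => Matrix.IsSymm.ext fun i j =>
    integral_congr_ae ((hHs y hy).mono fun z hz => hz.apply i j)
  have hEHq : ∀ y ∈ B, ∀ v, quadForm (EH y) v = ∫ z, Y v y z ∂P := fun y hy v =>
    quadForm_integral (hHi y hy) v
  have hEHc : ∀ y ∈ B, ∀ u, ‖u‖ = 1 → C₂ * a₃ ≤ -quadForm (EH y) u := fun y hy u hu => by
    have h1 := hcurv y hy
    have h2 : (Matrix.of fun i j => ∫ z, (-(H y z)) i j ∂P) = -EH y := by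
      ext i j
      simp only [Matrix.of_apply, Matrix.neg_apply, EH]
      exact integral_neg _
    have h3 : C₂ * a₃ ≤ lambdaMin (-EH y) := h2 ▸ h1
    rw [← quadForm_neg]
    exact h3.trans (lambdaMin_le_quadForm (hEHs y hy).neg hu)
  -- the net of directions
  obtain ⟨N, -, hN⟩ := exists_dyadic_nets_closedBall (0 : EuclideanSpace ℝ (Fin p)) one_pos
  obtain ⟨hV1, hVc, hVn⟩ := hN 2
  set V := N 2 with hV
  have hV1' : ∀ v ∈ V, ‖v‖ ≤ 1 := fun v hv => by simpa using hV1 hv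
  have hVn' : ∀ u : EuclideanSpace ℝ (Fin p), ‖u‖ ≤ 1 → ∃ v ∈ V, ‖u - v‖ ≤ 1 / 4 := fun u hu => by
    obtain ⟨v, hv, huv⟩ := hVn u (by simpa using hu)
    exact ⟨v, hv, huv.trans (by norm_num)⟩
  -- the event
  set m := max (d * a₂) (d ^ 2 * a₄) with hm
  have hm₁ : d * a₂ ≤ m := le_max_left _ _
  have hm₂ : d ^ 2 * a₄ ≤ m := le_max_right _ _
  have hm0 : 0 < m := lt_of_lt_of_le (by positivity) hm₁
  have hmw : m ≤ w := max_le hw₁ hw₃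
  have hfin : (Module.finrank ℝ (EuclideanSpace ℝ (Fin p)) : ℝ) ≤ C * n * d ^ 2 := by
    rw [finrank_euclideanSpace_fin]
    exact hpn
  obtain ⟨S, hSm, hSp, hS⟩ := exists_deviation_event (P := P) (V := V) hVc (g := g) (Y := Y)
    (x := θs) (r := η) (D := C₁ * a₄) (σ₁ := C₁ * a₁) (b₁ := C₁ * a₂) (σ₂ := C₁ * a₂)
    (b₂ := C₁ * a₄) hη (by positivity) (by positivity) (by positivity) (fun v _ => hgm v)
    (fun v hv => hgB v (hV1' v hv)) (fun v _ => hYm v) (fun v hv => hYB v (hV1' v hv))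
    (fun v hv => hYYB v (hV1' v hv)) (n := n)
    (G := fun Z => ∀ i, ContDiffOn ℝ 2 (M.logLik p (Z i)) B) (ae_pi_of_ae hC2)
    (fun Z hZ v _ => continuousOn_finsetSum _ fun i _ =>
      continuousOn_quadForm_hessianWithin hη (hZ i) v)
    (d := d) (C := C) hd hd1 hC hfin (hp1.trans hpn)
    -- l₁ makes the variance term exactly n d². l₂ is the smaller of d/(2C₁a₂), which keeps the
    -- variance term below n d²/4, and the Bernstein limit 1/(2C₁a₄). The thresholds t₁ and t₂ then
    -- leave 5Cnd² in the exponent.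
    (l₁ := d / (C₁ * a₁)) (t₁ := (5 * C + 1) * C₁ * n * d * a₁)
    (l₂ := d ^ 2 / (2 * C₁ * m)) (t₂ := (10 * C + 1 / 2) * C₁ * n * m)
    (by positivity) (by positivity)
    (by
      rw [div_mul_eq_mul_div, div_le_iff₀ (by positivity)]
      have : d * a₂ ≤ 1 / 2 * a₁ := by nlinarith
      nlinarith)
    (by
      rw [div_mul_eq_mul_div, div_le_iff₀ (by positivity)]
      nlinarith)
    (by
      have h1 : d / (C₁ * a₁) * ((5 * C + 1) * C₁ * n * d * a₁) = (5 * C + 1) * n * d ^ 2 := by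
        field_simp
      have h2 : (n : ℝ) * ((d / (C₁ * a₁)) ^ 2 * (C₁ * a₁) ^ 2) = n * d ^ 2 := by
        field_simp
      rw [h1, h2]
      linarith)
    (by
      have h1 : d ^ 2 / (2 * C₁ * m) * ((10 * C + 1 / 2) * C₁ * n * m) =
          (5 * C + 1 / 4) * n * d ^ 2 := by
        field_simp
        ring
      have h2 : d ^ 2 / (2 * C₁ * m) * (C₁ * a₂) ≤ d / 2 := by
        rw [div_mul_eq_mul_div, div_le_iff₀ (by positivity)]
        have := mul_le_mul_of_nonneg_left hm₁ (by positivity : 0 ≤ d * C₁)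
        linarith
      have h3 : (d ^ 2 / (2 * C₁ * m)) ^ 2 * (C₁ * a₂) ^ 2 ≤ (d / 2) ^ 2 := by
        rw [← mul_pow]
        exact pow_le_pow_left₀ (by positivity) h2 2
      have h4 := mul_le_mul_of_nonneg_left h3 hn0.le
      rw [h1]
      linarith)
  refine ⟨hae, S, hSm, hSp, fun Z hZ => ?_⟩
  obtain ⟨hG, hdev⟩ := hS Z hZ
  have hlogN : M.logLikN p Z = fun y => ∑ i, M.logLik p (Z i) y := rfl
  have hHN : ∀ y ∈ B, hessianWithin (M.logLikN p Z) B y = ∑ i, H y (Z i) := fun y hy =>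
    hessianWithin_sum_of_contDiffOn hη hG hy
  have hHNs : ∀ y ∈ B, (∑ i, H y (Z i)).IsSymm := fun y hy => by
    rw [← hHN y hy]
    exact hessianWithin_isSymm hη (ContDiffOn.sum fun i _ => hG i) hy
  have hsumq : ∀ y v, quadForm (∑ i, H y (Z i)) v = ∑ i, Y v y (Z i) := fun y v => by
    simp only [Y, quadForm, Matrix.sum_mulVec, dotProduct_sum]
  have hDop : ∀ y ∈ B, matrixOpNorm (∑ i, H y (Z i) - (n : ℝ) • EH y) ≤ C₂ / 2 * n * a₃ := by
    intro y hy
    refine (matrixOpNorm_le_of_net ((hHNs y hy).sub ((hEHs y hy).smul _))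
      (m := (154 * C + 5) * C₁ * n * w) (by positivity) hV1' hVn' fun v hv => ?_).trans ?_
    · have h1 : quadForm (∑ i, H y (Z i) - (n : ℝ) • EH y) v =
          ∑ i, (Y v y (Z i) - ∫ z, Y v y z ∂P) := by
        have h2 : quadForm ((n : ℝ) • EH y) v = n * quadForm (EH y) v := by
          simp [quadForm, Matrix.smul_mulVec, dotProduct_smul]
        rw [quadForm_sub, hsumq, h2, hEHq y hy]
        simp
      rw [h1]
      refine ((hdev v hv).2 y hy).trans ?_
      have h3 := mul_le_mul_of_nonneg_left hmw (by positivity : 0 ≤ (10 * C + 1 / 2) * C₁ * n)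
      have h4 := mul_le_mul_of_nonneg_left hw₂ (by positivity : 0 ≤ (144 * C + 4) * C₁ * n)
      have h5 : 0 ≤ C₁ * n * w := by positivity
      linarith
    · have := mul_le_mul_of_nonneg_left hw_curv hn0.le
      linarith
  have hquad : ∀ y ∈ B, ∀ u, ‖u‖ ≤ 1 →
      |quadForm (∑ i, H y (Z i)) u - n * quadForm (EH y) u| ≤ C₂ / 2 * n * a₃ := by
    intro y hy u hu
    have h2 : quadForm ((n : ℝ) • EH y) u = n * quadForm (EH y) u := by
      simp [quadForm, Matrix.smul_mulVec, dotProduct_smul]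
    rw [← h2, ← quadForm_sub]
    refine (abs_quadForm_le_matrixOpNorm _ u).trans ?_
    have h3 : ‖u‖ ^ 2 ≤ 1 := pow_le_one₀ (norm_nonneg u) hu
    have h4 : 0 ≤ matrixOpNorm (∑ i, H y (Z i) - (n : ℝ) • EH y) := norm_nonneg _
    exact (mul_le_of_le_one_right h4 h3).trans (hDop y hy)
  refine ⟨?_, fun y hy => ?_, fun y hy => ?_⟩
  -- 5C + 1 comes from the deviation and 1 from the mean of the score; the net doubles the sum.
  · refine (norm_le_of_net hVn' (m := (5 * C + 2) * C₁ * n * d * a₁) fun v hv => ?_).trans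
      (le_of_eq (by ring))
    have h1 : inner ℝ v (gradientWithin (M.logLikN p Z) B θs) =
        ∑ i, (g v (Z i) - ∫ z, g v z ∂P) + n * ∫ z, g v z ∂P := by
      rw [hlogN, gradientWithin_sum_of_contDiffOn hη hG hsB, inner_sum, Finset.sum_sub_distrib]
      simp [g, hB]
    rw [h1]
    refine (abs_add_le _ _).trans ((add_le_add (hdev v hv).1 (le_of_eq (abs_mul _ _))).trans ?_)
    rw [abs_of_pos hn0]
    have := mul_le_mul_of_nonneg_left (hEg v (hV1' v hv)) hn0.le
    linarith
  · rw [hHN y hy]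
    refine matrixOpNorm_le_of_abs_quadForm_le (hHNs y hy) (by positivity) fun u hu => ?_
    have h1 := hquad y hy u hu
    have h2 : |(n : ℝ) * quadForm (EH y) u| ≤ n * (C₁ * a₂) := by
      rw [abs_mul, abs_of_pos hn0, hEHq y hy]
      exact mul_le_mul_of_nonneg_left (hEY u hu y hy) hn0.le
    have h3 := abs_sub_abs_le_abs_sub (quadForm (∑ i, H y (Z i)) u) (n * quadForm (EH y) u)
    have h4 : C₂ / 2 * n * a₃ ≤ C₁ * n * a₂ := by
      have h5 : a₃ ≤ a₂ := ha₃1.trans h1a₂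
      gcongr
      linarith
    have h6 : 0 ≤ C * (C₁ * n * a₂) := by positivity
    have h7 : 0 ≤ C₁ * n * a₂ := by positivity
    linarith
  · rw [hHN y hy]
    refine le_lambdaMin_of_le_quadForm hp (hHNs y hy).neg fun u hu => ?_
    rw [quadForm_neg]
    have h1 := (abs_le.mp (hquad y hy u hu.le)).2
    have h2 := mul_le_mul_of_nonneg_left (hEHc y hy u hu) hn0.le
    linarith

end DominatedModel

theorem mainTheorem12
    (κ₁ κ₂ κ₃ κ₄ C C₁ C₂ : ℝ)
    (hκ₁ : 0 ≤ κ₁) (hκ₂ : 0 ≤ κ₂) (hκ₃ : 0 ≤ κ₃) (hκ₄ : 0 ≤ κ₄)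
    (hC : 0 < C) (hC₂ : 0 < C₂) (hC₁₂ : C₂ ≤ C₁) :
    ∃ cmin cmax : ℝ, 0 < cmin ∧ cmin ≤ cmax ∧
      ∀ δ : ℕ → ℝ, (∀ n, 1 ≤ n → 0 < δ n) → Filter.Tendsto δ Filter.atTop (nhds 0) →
        ∃ c' : ℝ, 0 < c' ∧
          ∀ (𝒵 : Type*) [MeasurableSpace 𝒵] (M : DominatedModel 𝒵) (n p : ℕ),
            1 ≤ n → 1 ≤ p →
            (∀ θ : EuclideanSpace ℝ (Fin p), embedRp p θ ∈ M.Θ) →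
            ∀ θ₀ ∈ M.Θ, ∀ (θs : EuclideanSpace ℝ (Fin p)) (η : ℝ), 0 < η → η ≤ 1 →
            (∀ᵐ Z ∂(M.lawN n θ₀), M.LogLikC2On p Z (Metric.closedBall θs η)) →
            DominatedModel.GrowthConditions n p η (δ n) κ₂ κ₃ κ₄ C →
            M.LocalMeanBoundedness p θ₀ θs η (δ n) κ₁ κ₂ κ₄ C₁ →
            M.LocalMeanCurvature p θ₀ θs η κ₃ C₂ →
            M.LocalBoundAndCurvature n p θ₀ θs η (δ n) κ₁ κ₂ κ₃ cmin cmax C c' := by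
  have hC₁ : 0 < C₁ := hC₂.trans_le hC₁₂
  refine ⟨C₂ / 2, (10 * C + 4) * C₁, by positivity, by nlinarith [mul_pos hC hC₁],
    fun δ hδ hδ0 => ?_⟩
  have hlog : Filter.Tendsto (fun n : ℕ => Real.log n) Filter.atTop Filter.atTop :=
    Real.tendsto_log_atTop.comp tendsto_natCast_atTop_atTop
  obtain ⟨N, hN⟩ := Filter.eventually_atTop.mp
    ((hδ0.eventually (ge_mem_nhds zero_lt_one)).and
      ((hlog.eventually_ge_atTop (2 / C)).and
        (hlog.eventually_ge_atTop (4 * ((154 * C + 5) * C₁) / (C * C₂)))))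
  have hsum : 0 ≤ ∑ k ∈ Finset.range N, Real.exp (C * k * δ k ^ 2) :=
    Finset.sum_nonneg fun k _ => (Real.exp_pos _).le
  refine ⟨8 + ∑ k ∈ Finset.range N, Real.exp (C * k * δ k ^ 2), by linarith, ?_⟩
  intro 𝒵 _ M n p hn hp hemb θ₀ hθ₀ θs η hη _ hae hgrowth hmean hcurv
  rcases lt_or_ge n N with hnN | hnN
  -- For n < N, the summand of the constant at k = n makes the required probability nonpositive, so
  -- the empty event suffices.
  · refine ⟨hae, ∅, MeasurableSet.empty, ?_, fun Z hZ => absurd hZ (Set.notMem_empty Z)⟩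
    rw [measureReal_empty, sub_nonpos, Real.exp_neg, ← div_eq_mul_inv,
      le_div_iff₀ (Real.exp_pos _), one_mul]
    have := Finset.single_le_sum (f := fun k : ℕ => Real.exp (C * k * δ k ^ 2))
      (fun k _ => (Real.exp_pos _).le) (Finset.mem_range.mpr hnN)
    linarith
  · obtain ⟨hd1, hl1, hl2⟩ := hN n hnN
    rw [div_le_iff₀ (by positivity)] at hl1 hl2
    obtain ⟨h1, E, hE, hEp, hEb⟩ := M.localBoundAndCurvature_of_le_log hκ₁ hκ₂ hκ₃ hC hC₂ hC₁₂
      hn hp hemb hθ₀ hη hae hgrowth hmean hcurv (hδ n hn) hd1 (by linarith) (by linarith)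
    refine ⟨h1, E, hE, le_trans ?_ hEp, hEb⟩
    have := mul_le_mul_of_nonneg_right (le_add_of_nonneg_right hsum : (8 : ℝ) ≤ 8 + _)
      (Real.exp_pos (-(C * n * δ n ^ 2))).le
    linarith
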